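/- For a finite sequence $\mathbf k=(k_1,\dots,k_n)$ of positive integers ($n\ge 1$) put $\mathrm{wt}(\mathbf k)=k_1+\cdots+k_n$, $\mathrm{dep}(\mathbf k)=n$ and $\mathrm{ht}(\mathbf k)=\#\{i: k_i\ge 2\}$; call $\mathbf k$ admissible if $k_1\ge 2$. For admissible $\mathbf k$ let $$\zeta(\mathbf k)=\sum_{m_1>\cdots>m_n>0}\frac1{m_1^{k_1}\cdots m_n^{k_n}},\qquad \zeta^t(\mathbf k)=\sum_{\mathbf p}t^{\,n-\mathrm{dep}(\mathbf p)}\zeta(\mathbf p)\in\mathbb R[t],$$ where $\mathbf p$ runs over all sequences $(k_1\,\square\, k_2\,\square\cdots\square\, k_n)$ in which each $\square$ is replaced by a comma or by a plus sign. For integers $k\ge n+s$, $n\ge s\ge 1$, let $X_0(k,n,s)\in\mathbb R[t]$ be the sum of $\zeta^t(\mathbf k)$ over all admissible $\mathbf k$ of weight $k$, depth $n$ and height $s$, and let $$\Phi_0(u,v,w)=\sum_{k\ge n+s,\ n\ge s\ge1}X_0(k,n,s)\,u^{k-n-s}v^{n-s}w^{2s-2}.$$ Let $F\left({a,b\atop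 c};z\right)=\sum_{n\ge0}\frac{(a)_n(b)_n}{n!\,(c)_n}z^n$ and ${}_3F_2\left({a_1,a_2,a_3\atop b_1,b_2};z\right)=\sum_{n\ge0}\frac{(a_1)_n(a_2)_n(a_3)_n}{n!\,(b_1)_n(b_2)_n}z^n$, where $(a)_n=a(a+1)\cdots(a+n-1)$. Let $t,u,v,w\in\mathbb C$ satisfy $|u|<1$, $|v|<1$, $|t||v|<1$ and $|t||w|^2<(1-|u|)(1-|t||v|)$ (for each fixed $t$ this is a neighbourhood of $u=v=w=0$), and let $\alpha,\beta,\gamma_1,\gamma_2\in\mathbb C$ satisfy $$\alpha+\beta=u+vt,\quad \alpha\beta=t(uv-w^2),\quad \gamma_1+\gamma_2=-u-(t-1)v,\quad \gamma_1\gamma_2=(t-1)(uv-w^2).$$ Then the series $\Phi_0(u,v,w)$, evaluated at $t$, converges absolutely, the integral and the series ${}_3F_2$ below converge absolutely, and $$\Phi_0(u,v,w)=\frac1{1-v}\int_0^1(1-z)^{-\beta}F\left({1-\gamma_1-\beta,\,1-\gamma_2-\beta\atop 2-v};z\right)dz=\frac1{(1-v)(1-\beta)}\;{}_3F_2\left({1-\gamma_1-\beta,\,1-\gamma_2-\beta,\,1\atop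 2-v,\,2-\beta};1\right).$$ -/

import Mathlib

open scoped Polynomial

/-- The multiple zeta value `ζ(k₁,…,kₙ) = ∑_{m₁ > ⋯ > mₙ > 0} 1 / (m₁^k₁ ⋯ mₙ^kₙ)`
(absolutely convergent for admissible indices). -/
noncomputable def mzv (k : List ℕ) : ℝ :=
  ∑' m : {m : Fin k.length → ℕ // StrictAnti m ∧ ∀ i, 0 < m i},
    ∏ i : Fin k.length, 1 / (m.1 i : ℝ) ^ k.get i

/-- All sequences `(a □ k₁ □ ⋯ □ kₙ)` in which each box is filled by a comma or by a plus. -/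
def fillBoxesAux : ℕ → List ℕ → List (List ℕ)
  | a, [] => [[a]]
  | a, b :: l => (fillBoxesAux b l).map (fun p => a :: p) ++ fillBoxesAux (a + b) l

/-- All sequences `(k₁ □ ⋯ □ kₙ)` in which each box is filled by a comma or by a plus. -/
def fillBoxes : List ℕ → List (List ℕ)
  | [] => [[]]
  | a :: l => fillBoxesAux a l

/-- The interpolated multiple zeta value `ζᵗ(k) = ∑_p t^(dep k - dep p) ζ(p) ∈ ℝ[t]`. -/
noncomputable def tmzv (k : List ℕ) : ℝ[X] :=
  ((fillBoxes k).map fun p => Polynomial.C (mzv p) * Polynomial.X ^ (k.length - p.length)).sum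

/-- The height of an index: the number of its entries that are at least `2`. -/
def indexHeight (k : List ℕ) : ℕ := k.countP fun a => decide (2 ≤ a)

/-- The set `I₀(k,n,s)` of admissible indices (first entry at least `2`) of weight `k`, depth `n`
and height `s`. A `Composition k` is a list of positive integers with sum `k`. -/
def admissibleIndices (k n s : ℕ) : Finset (Composition k) :=
  Finset.univ.filter fun c =>
    2 ≤ c.blocks.headD 0 ∧ c.blocks.length = n ∧ indexHeight c.blocks = s

/-- `X₀(k,n,s)`, the sum of `ζᵗ` over `I₀(k,n,s)`, a polynomial in `t`. -/
noncomputable def sumX0 (k n s : ℕ) : ℝ[X] :=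
  ∑ c ∈ admissibleIndices k n s, tmzv c.blocks

/-- The triples `(k,n,s)` with `k ≥ n + s` and `n ≥ s ≥ 1`. -/
abbrev Phi0Index : Type :=
  {q : ℕ × ℕ × ℕ // q.2.1 + q.2.2 ≤ q.1 ∧ q.2.2 ≤ q.2.1 ∧ 1 ≤ q.2.2}

/-- The term `X₀(k,n,s) u^(k-n-s) v^(n-s) w^(2s-2)` of the generating function, at `t ∈ ℂ`. -/
noncomputable def phi0Term (t u v w : ℂ) (q : Phi0Index) : ℂ :=
  Polynomial.aeval t (sumX0 q.1.1 q.1.2.1 q.1.2.2) *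
    u ^ (q.1.1 - q.1.2.1 - q.1.2.2) * v ^ (q.1.2.1 - q.1.2.2) * w ^ (2 * q.1.2.2 - 2)

/-- The generating function `Φ₀(u,v,w)`. -/
noncomputable def phi0 (t u v w : ℂ) : ℂ := ∑' q : Phi0Index, phi0Term t u v w q

/-- The Pochhammer symbol `(a)ₙ = a (a+1) ⋯ (a+n-1)`. -/
def pochhammer (a : ℂ) (n : ℕ) : ℂ := ∏ i ∈ Finset.range n, (a + i)

/-- The `n`-th term of the series `₃F₂(a₁,a₂,a₃; b₁,b₂; z)`. -/
noncomputable def hyp32Term (a₁ a₂ a₃ b₁ b₂ z : ℂ) (n : ℕ) : ℂ :=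
  pochhammer a₁ n * pochhammer a₂ n * pochhammer a₃ n /
    ((n.factorial : ℂ) * pochhammer b₁ n * pochhammer b₂ n) * z ^ n

/-- The generalized hypergeometric function `₃F₂(a₁,a₂,a₃; b₁,b₂; z)`. -/
noncomputable def hyp32 (a₁ a₂ a₃ b₁ b₂ z : ℂ) : ℂ := ∑' n : ℕ, hyp32Term a₁ a₂ a₃ b₁ b₂ z n

/-! ### Pochhammer symbols and their growth -/

open Filter Asymptotics Topology

/-! Filling a box by a plus amounts to letting two neighbouring summation indices coincide, so ζᵗ is
a sum over weakly decreasing m₁ ≥ m₂ ≥ ⋯ with one factor t for each equality (`headTerm_eq_sum`).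
Fix m₁ = n + 1 and sum over all tails (k₂, k₃, …), weighted by v for an entry 1 and by w²u^(a-2) for
an entry a ≥ 2. With y_j = v/(j+1) + w²/((j+1)(j+1-u)), the resulting generating function satisfies
G_n = 1 + ∑_{j<n} y_j G_j + t y_n G_n. This triangular recursion has the solution G_n = ∏_{j<n} (1 +
y_j/(1 - t y_j)) / (1 - t y_n) (`eq_localProd_div`, `hasSum_listWeight_tailSum`). The geometric sum
over the first entry then gives Φ₀ = ∑_n G_n / ((n+1)(n+1-u)).

At x = n + 1 the numerators of 1 - t y_n and 1 + (1-t) y_n are quadratics in x with roots α, β and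
-γ₁, -γ₂. Hence Φ₀ is ₃F₂(1+γ₁, 1+γ₂, 1; 2-α, 2-β; 1) / ((1-α)(1-β)) (`RootParams.summand_eq`).
Thomae's transformation with one numerator parameter equal to 1 (`unitHyp_transform`), proved by
iterating a telescoping contiguous relation, turns it into the stated ₃F₂. Termwise integration of
the Gauss series (`integral_hypergeometric`) yields the integral.

All interchanges of sums are justified by the same computation for |t|, |u|, |v|, |w|: finite
partial sums of the nonnegative tail series are bounded by the closed form
(`sum_listWeight_tailSum_le`), which is summable over n because |v| < 1. -/

theorem pochhammer_succ (a : ℂ) (n : ℕ) :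
    pochhammer a (n + 1) = pochhammer a n * (a + n) := by
  simp [pochhammer, Finset.prod_range_succ]

theorem pochhammer_succ_left (a : ℂ) (n : ℕ) :
    pochhammer a (n + 1) = a * pochhammer (a + 1) n := by
  rw [pochhammer, Finset.prod_range_succ', pochhammer, mul_comm]
  simp [add_assoc, add_comm (1 : ℂ)]

theorem pochhammer_one (n : ℕ) : pochhammer 1 n = n.factorial := by
  induction n with
  | zero => simp [pochhammer]
  | succ n ih => rw [pochhammer_succ, ih, Nat.factorial_succ]; push_cast; ring

theorem pochhammer_ne_zero {a : ℂ} (ha : 0 < a.re) (n : ℕ) : pochhammer a n ≠ 0 := by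
  refine Finset.prod_ne_zero_iff.2 fun i _ h => ?_
  have := congrArg Complex.re h
  simp at this
  have hi : (0 : ℝ) ≤ i := i.cast_nonneg
  linarith

theorem ascPochhammer_eval_eq_pochhammer (a : ℂ) (n : ℕ) :
    (ascPochhammer ℂ n).eval a = pochhammer a n := by
  induction n with
  | zero => simp [pochhammer]
  | succ n ih => rw [ascPochhammer_succ_eval, ih, pochhammer_succ]

theorem gammaSeq_eq_pochhammer (a : ℂ) (n : ℕ) :
    Complex.GammaSeq a n = (n : ℂ) ^ a * n.factorial / pochhammer a (n + 1) := rfl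

/-- Euler's limit n^a n! / (a)_{n+1} → Γ(a), inverted. Inversion needs Γ(a) to be a genuine nonzero
value; at the poles a = -m the symbol vanishes from some point on. -/
theorem pochhammer_isBigO (a : ℂ) :
    (fun n : ℕ => pochhammer a (n + 1)) =O[atTop]
      fun n : ℕ => (n : ℝ) ^ a.re * n.factorial := by
  by_cases ha : ∃ m : ℕ, a = -m
  · obtain ⟨m, rfl⟩ := ha
    refine EventuallyEq.trans_isBigO ?_ (isBigO_zero _ _)
    filter_upwards [eventually_ge_atTop m] with n hn
    exact Finset.prod_eq_zero (Finset.mem_range.2 (Nat.lt_succ_of_le hn)) (by simp)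
  · push Not at ha
    have h := ((Complex.GammaSeq_tendsto_Gamma a).inv₀ (Complex.Gamma_ne_zero ha)).isBigO_one ℝ
    have h2 : (fun n : ℕ => (n : ℂ) ^ a * n.factorial) =O[atTop]
        fun n : ℕ => (n : ℝ) ^ a.re * n.factorial := by
      refine IsBigO.of_bound 1 ?_
      filter_upwards [eventually_gt_atTop 0] with n hn
      rw [norm_mul, Complex.norm_natCast_cpow_of_pos hn, one_mul, Complex.norm_natCast, norm_mul,
        RCLike.norm_natCast, Real.norm_of_nonneg (by positivity)]
    refine ((h2.mul h).congr' ?_ ?_)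
    · filter_upwards [eventually_gt_atTop 0] with n hn
      have h0 : (n : ℂ) ≠ 0 := by exact_mod_cast hn.ne'
      have h1 : (n : ℂ) ^ a ≠ 0 := by simp [Complex.cpow_eq_zero_iff, h0]
      have h3 : (n.factorial : ℂ) ≠ 0 := by exact_mod_cast n.factorial_ne_zero
      rw [gammaSeq_eq_pochhammer, inv_div]
      field_simp
    · exact Eventually.of_forall fun n => mul_one _

theorem inv_pochhammer_isBigO (a : ℂ) :
    (fun n : ℕ => (pochhammer a (n + 1))⁻¹) =O[atTop]
      fun n : ℕ => (n : ℝ) ^ (-a.re) * (n.factorial : ℝ)⁻¹ := by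
  have h := (Complex.GammaSeq_tendsto_Gamma a).isBigO_one ℝ
  have h2 : (fun n : ℕ => ((n : ℂ) ^ a * n.factorial)⁻¹) =O[atTop]
      fun n : ℕ => (n : ℝ) ^ (-a.re) * (n.factorial : ℝ)⁻¹ := by
    refine IsBigO.of_bound 1 ?_
    filter_upwards [eventually_gt_atTop 0] with n hn
    rw [norm_inv, norm_mul, Complex.norm_natCast_cpow_of_pos hn, one_mul, Complex.norm_natCast,
      norm_mul, norm_inv, RCLike.norm_natCast, Real.norm_of_nonneg (by positivity),
      Real.rpow_neg (by positivity), mul_inv]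
  refine ((h2.mul h).congr' ?_ ?_)
  · filter_upwards [eventually_gt_atTop 0] with n hn
    have h0 : (n : ℂ) ≠ 0 := by exact_mod_cast hn.ne'
    have h1 : (n : ℂ) ^ a ≠ 0 := by simp [Complex.cpow_eq_zero_iff, h0]
    have h3 : (n.factorial : ℂ) ≠ 0 := by exact_mod_cast n.factorial_ne_zero
    rw [gammaSeq_eq_pochhammer]
    field_simp
  · exact Eventually.of_forall fun n => mul_one _

/-- The growth of a quotient of Pochhammer symbols. -/
theorem pochhammer_quot_isBigO (a b c d : ℂ) :
    (fun n : ℕ => pochhammer a (n + 1) * pochhammer b (n + 1) /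
      (pochhammer c (n + 1) * pochhammer d (n + 1))) =O[atTop]
      fun n : ℕ => (n : ℝ) ^ (a.re + b.re - c.re - d.re) := by
  refine (((pochhammer_isBigO a).mul (pochhammer_isBigO b)).mul
    ((inv_pochhammer_isBigO c).mul (inv_pochhammer_isBigO d))).congr' ?_ ?_
  · exact Eventually.of_forall fun n => by simp only [div_eq_mul_inv, mul_inv]
  · filter_upwards [eventually_gt_atTop 0] with n hn
    have h0 : (0 : ℝ) < n := by exact_mod_cast hn
    have h3 : (n.factorial : ℝ) ≠ 0 := by exact_mod_cast n.factorial_ne_zero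
    rw [sub_eq_add_neg, sub_eq_add_neg, Real.rpow_add h0, Real.rpow_add h0, Real.rpow_add h0]
    field_simp

theorem pochhammer_quot_summable {a b c d : ℂ} (h : a.re + b.re + 1 < c.re + d.re) :
    Summable fun n : ℕ => ‖pochhammer a n * pochhammer b n / (pochhammer c n * pochhammer d n)‖ := by
  rw [← summable_nat_add_iff 1]
  refine summable_of_isBigO_nat ?_ (pochhammer_quot_isBigO a b c d).norm_left
  rw [Real.summable_nat_rpow]
  linarith

theorem pochhammer_quot_tendsto {a b c d : ℂ} (h : a.re + b.re < c.re + d.re) :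
    Tendsto (fun n : ℕ => pochhammer a n * pochhammer b n / (pochhammer c n * pochhammer d n))
      atTop (𝓝 0) := by
  rw [← tendsto_add_atTop_iff_nat 1]
  refine (pochhammer_quot_isBigO a b c d).trans_tendsto ?_
  have := (tendsto_rpow_neg_atTop (y := -(a.re + b.re - c.re - d.re)) (by linarith)).comp
    tendsto_natCast_atTop_atTop
  simpa [Function.comp_def] using this

/-! ### Thomae's transformation for ₃F₂ at 1 with a unit parameter -/

/-- The term of a `₃F₂` series at `1` with one numerator parameter equal to `1`, normalised. -/
noncomputable def unitHypTerm (b c d e : ℂ) (n : ℕ) : ℂ :=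
  pochhammer b n * pochhammer c n / (pochhammer d n * pochhammer e (n + 1))

theorem unitHypTerm_eq (b c d e : ℂ) (n : ℕ) : unitHypTerm b c d e n =
    e⁻¹ * (pochhammer b n * pochhammer c n / (pochhammer d n * pochhammer (e + 1) n)) := by
  rw [unitHypTerm, pochhammer_succ_left, div_eq_mul_inv, div_eq_mul_inv]
  simp only [mul_inv]
  ring

theorem unitHypTerm_summable {b c d e : ℂ} (h : b.re + c.re < d.re + e.re) :
    Summable fun n => ‖unitHypTerm b c d e n‖ := by
  simp_rw [unitHypTerm_eq, norm_mul e⁻¹]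
  refine (pochhammer_quot_summable ?_).mul_left _
  simp
  linarith

/-- Contiguous relation between d and d + 1: the combination of the two series telescopes termwise
through (b)_n (c)_n / ((d)_n (e)_n), which tends to 0 exactly because the excess s has positive real
part. -/
theorem unitHyp_step {b c d e s : ℂ} (hd : 0 < d.re) (he : 0 < e.re) (hs : 0 < s.re)
    (h : s = d + e - b - c) :
    ∑' n, unitHypTerm b c d e n =
      1 / s + (d - b) * (d - c) / (d * s) * ∑' n, unitHypTerm b c (d + 1) e n := by
  have hre : b.re + c.re < d.re + e.re := by
    rw [h] at hs; simp at hs; linarith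
  have hs0 : s ≠ 0 := fun h => by simp [h] at hs
  have hd0 : d ≠ 0 := fun h => by simp [h] at hd
  set g : ℕ → ℂ := fun n => pochhammer b n * pochhammer c n / (pochhammer d n * pochhammer e n)
  have hg : Tendsto g atTop (𝓝 0) := pochhammer_quot_tendsto hre
  have h1 : Summable (unitHypTerm b c d e) := (unitHypTerm_summable hre).of_norm
  have h2 : Summable (unitHypTerm b c (d + 1) e) :=
    (unitHypTerm_summable (by simp; linarith)).of_norm
  have key : ∀ n, s * unitHypTerm b c d e n -
      (d - b) * (d - c) / d * unitHypTerm b c (d + 1) e n = g n - g (n + 1) := by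
    intro n
    have a1 : pochhammer (d + 1) n = pochhammer d n * (d + n) / d := by
      rw [← pochhammer_succ, pochhammer_succ_left]; field_simp
    have p1 := pochhammer_ne_zero hd n
    have p2 := pochhammer_ne_zero he n
    have p3 : d + n ≠ 0 := right_ne_zero_of_mul (pochhammer_succ d n ▸ pochhammer_ne_zero hd (n + 1))
    have p4 : e + n ≠ 0 := right_ne_zero_of_mul (pochhammer_succ e n ▸ pochhammer_ne_zero he (n + 1))
    simp only [g, unitHypTerm, a1, pochhammer_succ]
    field_simp
    rw [h]
    ring
  have h3 : HasSum (fun n => g n - g (n + 1)) (g 0) := by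
    have h4 : Summable fun n => g n - g (n + 1) := by
      simp_rw [← key]
      exact (h1.mul_left _).sub (h2.mul_left _)
    refine (h4.hasSum_iff_tendsto_nat).2 ?_
    simp_rw [Finset.sum_range_sub']
    simpa using tendsto_const_nhds.sub hg
  have h4 := (h1.hasSum.mul_left s).sub (h2.hasSum.mul_left ((d - b) * (d - c) / d))
  simp_rw [key] at h4
  have h5 := h4.unique h3
  have h6 : g 0 = 1 := by simp [g, pochhammer]
  rw [h6] at h5
  rw [sub_eq_iff_eq_add] at h5
  field_simp
  field_simp at h5
  linear_combination h5

/-- Thomae's transformation for a numerator parameter equal to `1`. -/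
theorem unitHyp_transform {b c d e s : ℂ} (hd : 0 < d.re) (he : 0 < e.re) (hs : 0 < s.re)
    (h : s = d + e - b - c) :
    ∑' n, unitHypTerm b c d e n = ∑' n, unitHypTerm (d - b) (d - c) d s n := by
  have hre : b.re + c.re < d.re + e.re := by
    rw [h] at hs; simp at hs; linarith
  set r : ℕ → ℂ := fun K => pochhammer (d - b) K * pochhammer (d - c) K /
    (pochhammer d K * pochhammer s K)
  -- Each use of the contiguous relation raises d and s by one and splits off one term of the target
  -- series; `r K` collects the accumulated factors.
  have hiter : ∀ K : ℕ, ∑' n, unitHypTerm b c d e n =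
      ∑ n ∈ Finset.range K, unitHypTerm (d - b) (d - c) d s n +
        r K * ∑' n, unitHypTerm b c (d + K) e n := by
    intro K
    induction K with
    | zero => simp [r, pochhammer]
    | succ K ih =>
      have p1 := pochhammer_ne_zero hd K
      have p2 := pochhammer_ne_zero hs K
      have p3 : d + K ≠ 0 :=
        right_ne_zero_of_mul (pochhammer_succ d K ▸ pochhammer_ne_zero hd (K + 1))
      have p4 : s + K ≠ 0 :=
        right_ne_zero_of_mul (pochhammer_succ s K ▸ pochhammer_ne_zero hs (K + 1))
      have hK : (0 : ℝ) ≤ K := K.cast_nonneg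
      rw [ih, unitHyp_step (d := d + K) (s := s + K) (by simp; linarith) he (by simp; linarith)
        (by rw [h]; ring), Finset.sum_range_succ]
      simp only [r, unitHypTerm, pochhammer_succ]
      push_cast
      rw [← add_assoc d (K : ℂ) 1]
      field_simp
      ring
  -- Since (d - b) + (d - c) = d + s - e, the decay of `r` is governed by Re e > 0.
  have hr : Tendsto r atTop (𝓝 0) := by
    refine pochhammer_quot_tendsto ?_
    have := congrArg Complex.re h
    simp at this ⊢
    linarith
  -- As Re d > 0, shifting d by K ≥ 0 only enlarges every factor |d + i| of the denominator.
  have hbound : ∀ K : ℕ, ‖∑' n, unitHypTerm b c (d + K) e n‖ ≤ ∑' n, ‖unitHypTerm b c d e n‖ := by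
    intro K
    refine tsum_of_norm_bounded (unitHypTerm_summable hre).hasSum fun n => ?_
    rw [unitHypTerm, unitHypTerm, norm_div, norm_div, norm_mul (pochhammer (d + K) n),
      norm_mul (pochhammer d n)]
    have p1 := norm_pos_iff.2 (pochhammer_ne_zero hd n)
    have p2 := norm_pos_iff.2 (pochhammer_ne_zero he (n + 1))
    gcongr
    rw [pochhammer, pochhammer, norm_prod, norm_prod]
    refine Finset.prod_le_prod (fun i _ => norm_nonneg _) fun i _ => ?_
    have hK : (0 : ℝ) ≤ K := K.cast_nonneg
    have hi : (0 : ℝ) ≤ i := i.cast_nonneg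
    rw [Complex.norm_def, Complex.norm_def]
    refine Real.sqrt_le_sqrt ?_
    rw [Complex.normSq_apply, Complex.normSq_apply]
    simp
    nlinarith
  have hlim : Tendsto (fun K : ℕ => r K * ∑' n, unitHypTerm b c (d + K) e n) atTop (𝓝 0) := by
    rw [tendsto_zero_iff_norm_tendsto_zero] at hr ⊢
    refine squeeze_zero (fun _ => norm_nonneg _) (fun K => ?_)
      (by simpa using hr.mul_const (∑' n, ‖unitHypTerm b c d e n‖))
    rw [norm_mul]
    exact mul_le_mul_of_nonneg_left (hbound K) (norm_nonneg _)
  have hsum : Summable (unitHypTerm (d - b) (d - c) d s) := by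
    refine (unitHypTerm_summable ?_).of_norm
    have := congrArg Complex.re h
    simp at this ⊢
    linarith
  have h7 := hsum.hasSum.tendsto_sum_nat.add hlim
  simp_rw [← hiter] at h7
  simpa using tendsto_nhds_unique tendsto_const_nhds h7

/-! ### Termwise integration of the Gauss series -/

open MeasureTheory in
theorem integrable_tsum_of_summable_integral_norm {X : Type*} [MeasurableSpace X] {μ : Measure X}
    {F : ℕ → X → ℂ} (hF : ∀ i, Integrable (F i) μ) (hs : Summable fun i => ∫ a, ‖F i a‖ ∂μ) :
    Integrable (fun a => ∑' i, F i a) μ := by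
  have hfin : ∫⁻ a, ∑' i, ‖F i a‖ₑ ∂μ < ⊤ := by
    rw [lintegral_tsum fun i => (hF i).1.enorm]
    have h1 : ∀ i, ∫⁻ a, ‖F i a‖ₑ ∂μ = ENNReal.ofReal (∫ a, ‖F i a‖ ∂μ) := fun i =>
      (ofReal_integral_norm_eq_lintegral_enorm (hF i)).symm
    simp_rw [h1]
    rw [← ENNReal.ofReal_tsum_of_nonneg (fun i => integral_nonneg fun a => norm_nonneg _) hs]
    exact ENNReal.ofReal_lt_top
  have hmeas : AEMeasurable (fun a => ∑' i, ‖F i a‖ₑ) μ :=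
    AEMeasurable.tsum fun i => (hF i).1.enorm
  refine ⟨?_, ?_⟩
  · refine aestronglyMeasurable_of_tendsto_ae atTop
      (f := fun n a => ∑ i ∈ Finset.range n, F i a)
      (fun n => Finset.aestronglyMeasurable_fun_sum _ fun i _ => (hF i).1) ?_
    filter_upwards [ae_lt_top' hmeas hfin.ne] with a ha
    have : Summable fun i => F i a := by
      refine Summable.of_nnnorm ?_
      exact ENNReal.tsum_coe_ne_top_iff_summable.1 ha.ne
    exact this.hasSum.tendsto_sum_nat
  · refine lt_of_le_of_lt (lintegral_mono fun a => ?_) hfin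
    exact enorm_tsum_le_tsum_enorm

theorem betaIntegral_nat_eq {e : ℂ} (he : 0 < e.re) (n : ℕ) :
    ∫ z : ℝ in Set.Ioo (0 : ℝ) 1, (1 - (z : ℂ)) ^ (e - 1) * (z : ℂ) ^ n =
      n.factorial / pochhammer e (n + 1) := by
  rw [← MeasureTheory.integral_Ioc_eq_integral_Ioo, ← intervalIntegral.integral_of_le zero_le_one]
  have h := Complex.betaIntegral_eval_nat_add_one_right he n
  rw [← Complex.betaIntegral_symm] at h
  rw [pochhammer, ← h, Complex.betaIntegral]
  refine intervalIntegral.integral_congr fun z _ => ?_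
  simp [mul_comm]

theorem betaIntegrand_nat_integrable {e : ℂ} (he : 0 < e.re) (n : ℕ) :
    MeasureTheory.IntegrableOn (fun z : ℝ => (1 - (z : ℂ)) ^ (e - 1) * (z : ℂ) ^ n)
      (Set.Ioo (0 : ℝ) 1) := by
  have h := Complex.betaIntegral_convergent (u := n + 1) (v := e)
    (by simp; positivity) he
  rw [intervalIntegrable_iff_integrableOn_Ioo_of_le zero_le_one] at h
  refine h.congr_fun (fun z _ => ?_) measurableSet_Ioo
  simp [mul_comm]

/-- On (0,1) one has |(1-z)^(e-1)| = (1-z)^(Re e - 1), so taking norms replaces e by Re e in the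
beta integral. The norms of the integrated terms thus form a series of the same hypergeometric type.
-/
theorem betaIntegral_norm_eq {e : ℂ} (he : 0 < e.re) (n : ℕ) :
    ∫ z : ℝ in Set.Ioo (0 : ℝ) 1, ‖(1 - (z : ℂ)) ^ (e - 1) * (z : ℂ) ^ n‖ =
      ‖(n.factorial / pochhammer (e.re : ℂ) (n + 1) : ℂ)‖ := by
  rw [← betaIntegral_nat_eq (by simpa using he)]
  have h : ∫ z : ℝ in Set.Ioo (0 : ℝ) 1, (1 - (z : ℂ)) ^ ((e.re : ℂ) - 1) * (z : ℂ) ^ n =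
      ((∫ z : ℝ in Set.Ioo (0 : ℝ) 1, ‖(1 - (z : ℂ)) ^ (e - 1) * (z : ℂ) ^ n‖ : ℝ) : ℂ) := by
    rw [← integral_complex_ofReal]
    refine MeasureTheory.setIntegral_congr_fun measurableSet_Ioo fun z hz => ?_
    have h1 : (0 : ℝ) < 1 - z := by linarith [hz.2]
    have h2 : (1 - (z : ℂ)) = ((1 - z : ℝ) : ℂ) := by push_cast; ring
    have h3 : ((e.re : ℂ) - 1) = ((e.re - 1 : ℝ) : ℂ) := by push_cast; ring
    rw [h2, norm_mul, Complex.norm_cpow_eq_rpow_re_of_pos h1, norm_pow, Complex.norm_real,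
      Real.norm_of_nonneg hz.1.le, h3, ← Complex.ofReal_cpow h1.le]
    simp
  rw [h, Complex.norm_real, Real.norm_of_nonneg
    (MeasureTheory.integral_nonneg fun z => norm_nonneg _)]

/-- Termwise integration of the Gauss hypergeometric series against a power of `1 - z`. -/
theorem integral_hypergeometric {a b c e : ℂ} (he : 0 < e.re) (h : a.re + b.re < c.re + e.re) :
    IntervalIntegrable (fun z : ℝ => (1 - (z : ℂ)) ^ (e - 1) *
      ordinaryHypergeometric a b c (z : ℂ)) MeasureTheory.volume 0 1 ∧
    ∫ z : ℝ in (0 : ℝ)..1, (1 - (z : ℂ)) ^ (e - 1) * ordinaryHypergeometric a b c (z : ℂ) =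
      ∑' n, unitHypTerm a b c e n := by
  set q : ℕ → ℂ := fun n => pochhammer a n * pochhammer b n / (n.factorial * pochhammer c n)
  set F : ℕ → ℝ → ℂ := fun n z => q n * ((1 - (z : ℂ)) ^ (e - 1) * (z : ℂ) ^ n)
  have hf : ∀ n : ℕ, (n.factorial : ℂ) ≠ 0 := fun n => by exact_mod_cast n.factorial_ne_zero
  have hF : (fun z : ℝ => (1 - (z : ℂ)) ^ (e - 1) * ordinaryHypergeometric a b c (z : ℂ)) =
      fun z => ∑' n, F n z := by
    funext z
    rw [ordinaryHypergeometric_eq_tsum, ← tsum_mul_left]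
    refine tsum_congr fun n => ?_
    simp only [F, q, ascPochhammer_eval_eq_pochhammer, smul_eq_mul, div_eq_mul_inv, mul_inv]
    ring
  have hint : ∀ n, MeasureTheory.IntegrableOn (F n) (Set.Ioo (0 : ℝ) 1) := fun n =>
    (betaIntegrand_nat_integrable he n).const_mul _
  have hval : ∀ (e' : ℂ) (n : ℕ), q n * (n.factorial / pochhammer e' (n + 1)) =
      unitHypTerm a b c e' n := by
    intro e' n
    have := hf n
    simp only [q, unitHypTerm, div_eq_mul_inv, mul_inv]
    field_simp
  have hsum : Summable fun n => ∫ z in Set.Ioo (0 : ℝ) 1, ‖F n z‖ := by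
    have : ∀ n, ∫ z in Set.Ioo (0 : ℝ) 1, ‖F n z‖ = ‖unitHypTerm a b c (e.re : ℂ) n‖ := by
      intro n
      simp only [F]
      simp_rw [norm_mul (q n)]
      rw [MeasureTheory.integral_const_mul, betaIntegral_norm_eq he, ← norm_mul, hval]
    simp_rw [this]
    exact unitHypTerm_summable (by simpa using h)
  rw [hF]
  constructor
  · rw [intervalIntegrable_iff_integrableOn_Ioo_of_le zero_le_one]
    exact integrable_tsum_of_summable_integral_norm hint hsum
  · rw [intervalIntegral.integral_of_le zero_le_one, MeasureTheory.integral_Ioc_eq_integral_Ioo,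
      ← (MeasureTheory.hasSum_integral_of_summable_integral_norm hint hsum).tsum_eq]
    refine tsum_congr fun n => ?_
    simp only [F]
    rw [MeasureTheory.integral_const_mul, betaIntegral_nat_eq he, hval]

theorem hyp32Term_one_eq {a b c e : ℂ} (he : e ≠ 0) (n : ℕ) :
    hyp32Term a b 1 c (e + 1) 1 n = e * unitHypTerm a b c e n := by
  have : (n.factorial : ℂ) ≠ 0 := by exact_mod_cast n.factorial_ne_zero
  rw [unitHypTerm_eq, hyp32Term, pochhammer_one, one_pow]
  simp only [div_eq_mul_inv, mul_inv]
  field_simp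

/-! ### The recursion for the tail generating function and its solution -/

/-- The generating function of the weights of a single entry at the summation index `n + 1`. -/
def entryGen {K : Type*} [Field K] (u v w : K) (n : ℕ) : K :=
  v / (n + 1) + w ^ 2 / ((n + 1) * (n + 1 - u))

/-- The product of the local factors `1 + y_j + t y_j ^ 2 + ⋯` over `j < n`. -/
def localProd {K : Type*} [Field K] (t : K) (y : ℕ → K) (n : ℕ) : K :=
  ∏ j ∈ Finset.range n, (1 + y j / (1 - t * y j))

section Field
variable {K : Type*} [Field K]

/-- Telescoping: consecutive products differ by the product up to n times y_n / (1 - t y_n). -/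
theorem localProd_eq_sum (t : K) (y : ℕ → K) (n : ℕ) :
    localProd t y n =
      1 + ∑ j ∈ Finset.range n, y j * (localProd t y j / (1 - t * y j)) := by
  induction n with
  | zero => simp [localProd]
  | succ n ih =>
    rw [Finset.sum_range_succ, ← add_assoc, ← ih, localProd, Finset.prod_range_succ, ← localProd]
    ring

theorem localProd_div_eq {t : K} {y : ℕ → K} {n : ℕ} (h : 1 - t * y n ≠ 0) :
    localProd t y n / (1 - t * y n) =
      1 + ∑ j ∈ Finset.range n, y j * (localProd t y j / (1 - t * y j)) +
        t * (y n * (localProd t y n / (1 - t * y n))) := by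
  rw [← localProd_eq_sum]
  field_simp
  ring

/-- The recursion is triangular, and 1 - t y_n ≠ 0 lets the diagonal term be solved for, so it has
only one solution. -/
theorem eq_localProd_div {t : K} {y G : ℕ → K} (h : ∀ n, 1 - t * y n ≠ 0)
    (hG : ∀ n, G n = 1 + ∑ j ∈ Finset.range n, y j * G j + t * (y n * G n)) (n : ℕ) :
    G n = localProd t y n / (1 - t * y n) := by
  induction n using Nat.strong_induction_on with
  | _ n ih =>
    rw [eq_div_iff (h n), localProd_eq_sum]
    rw [Finset.sum_congr rfl fun j hj => by rw [← ih j (Finset.mem_range.1 hj)]]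
    linear_combination hG n

end Field

/-! ### Factorisation of the local factors by α, β, γ₁, γ₂ -/

/-- If |x| ≥ 1, then |x - u| |x - vt| ≥ (1 - |u|)(1 - |t||v|) > |t||w|². The equation is the one
satisfied by α and β, so n + 1 - α and n + 1 - β never vanish. -/
theorem norm_root_lt_one {t u v w x : ℂ} (htv : ‖t‖ * ‖v‖ < 1)
    (hw : ‖t‖ * ‖w‖ ^ 2 < (1 - ‖u‖) * (1 - ‖t‖ * ‖v‖)) (hx : (x - u) * (x - v * t) = t * w ^ 2) :
    ‖x‖ < 1 := by
  by_contra! h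
  have h1 : 1 - ‖u‖ ≤ ‖x - u‖ := by linarith [norm_sub_norm_le x u]
  have h2 : 1 - ‖t‖ * ‖v‖ ≤ ‖x - v * t‖ := by
    have := norm_sub_norm_le x (v * t)
    rw [norm_mul, mul_comm ‖v‖] at this
    linarith
  have h3 := congrArg norm hx
  rw [norm_mul, norm_mul, norm_pow] at h3
  have := mul_le_mul h1 h2 (by linarith) (norm_nonneg _)
  linarith

theorem natCast_add_one_sub_ne_zero {x : ℂ} (hx : ‖x‖ < 1) (n : ℕ) : (n : ℂ) + 1 - x ≠ 0 := by
  intro h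
  have h1 : x = ((n + 1 : ℕ) : ℂ) := by push_cast; linear_combination -h
  rw [h1, Complex.norm_natCast] at hx
  push_cast at hx
  linarith [n.cast_nonneg (α := ℝ)]

/-- The relations between the parameters of the generating function and those of the
hypergeometric series. -/
structure RootParams (t u v w α β γ₁ γ₂ : ℂ) : Prop where
  hu : ‖u‖ < 1
  htv : ‖t‖ * ‖v‖ < 1
  hw : ‖t‖ * ‖w‖ ^ 2 < (1 - ‖u‖) * (1 - ‖t‖ * ‖v‖)
  sum_αβ : α + β = u + v * t
  mul_αβ : α * β = t * (u * v - w ^ 2)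
  sum_γ : γ₁ + γ₂ = -u - (t - 1) * v
  mul_γ : γ₁ * γ₂ = (t - 1) * (u * v - w ^ 2)

namespace RootParams
variable {t u v w α β γ₁ γ₂ : ℂ}

theorem norm_α (h : RootParams t u v w α β γ₁ γ₂) : ‖α‖ < 1 :=
  norm_root_lt_one h.htv h.hw (by linear_combination α * h.sum_αβ - h.mul_αβ)

theorem norm_β (h : RootParams t u v w α β γ₁ γ₂) : ‖β‖ < 1 :=
  norm_root_lt_one h.htv h.hw (by linear_combination β * h.sum_αβ - h.mul_αβ)

theorem one_sub_entryGen (h : RootParams t u v w α β γ₁ γ₂) (n : ℕ) :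
    1 - t * entryGen u v w n = (n + 1 - α) * (n + 1 - β) / ((n + 1) * (n + 1 - u)) := by
  have h0 := Nat.cast_add_one_ne_zero (R := ℂ) n
  have h1 := natCast_add_one_sub_ne_zero h.hu n
  rw [entryGen]
  field_simp
  linear_combination ((n : ℂ) + 1) * h.sum_αβ - h.mul_αβ

theorem one_sub_entryGen_ne_zero (h : RootParams t u v w α β γ₁ γ₂) (n : ℕ) :
    1 - t * entryGen u v w n ≠ 0 := by
  rw [h.one_sub_entryGen]
  exact div_ne_zero (mul_ne_zero (natCast_add_one_sub_ne_zero h.norm_α n)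
    (natCast_add_one_sub_ne_zero h.norm_β n)) (mul_ne_zero (Nat.cast_add_one_ne_zero n)
    (natCast_add_one_sub_ne_zero h.hu n))

theorem localFactor (h : RootParams t u v w α β γ₁ γ₂) (n : ℕ) :
    1 + entryGen u v w n / (1 - t * entryGen u v w n) =
      (n + 1 + γ₁) * (n + 1 + γ₂) / ((n + 1 - α) * (n + 1 - β)) := by
  have h2 := h.one_sub_entryGen_ne_zero n
  have h0 := Nat.cast_add_one_ne_zero (R := ℂ) n
  have h1 := natCast_add_one_sub_ne_zero h.hu n
  have h3 : 1 + entryGen u v w n / (1 - t * entryGen u v w n) =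
      (1 - t * entryGen u v w n + entryGen u v w n) / (1 - t * entryGen u v w n) := by
    rw [add_div, div_self h2]
  have h4 : 1 - t * entryGen u v w n + entryGen u v w n =
      (n + 1 + γ₁) * (n + 1 + γ₂) / ((n + 1) * (n + 1 - u)) := by
    rw [entryGen]
    field_simp
    linear_combination -((n : ℂ) + 1) * h.sum_γ - h.mul_γ
  rw [h3, h4, h.one_sub_entryGen, div_div_div_cancel_right₀ (mul_ne_zero h0 h1)]

theorem localProd_eq (h : RootParams t u v w α β γ₁ γ₂) (n : ℕ) :
    localProd t (entryGen u v w) n = pochhammer (1 + γ₁) n * pochhammer (1 + γ₂) n /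
      (pochhammer (1 - α) n * pochhammer (1 - β) n) := by
  rw [localProd, Finset.prod_congr rfl fun j _ => h.localFactor j]
  simp only [pochhammer, Finset.prod_div_distrib, Finset.prod_mul_distrib]
  congr 2 <;> refine Finset.prod_congr rfl fun j _ => by ring

/-- The factor (n+1)(n+1-u) from the first entry cancels the denominator of 1 - t y_n, so u survives
only through the roots. Of the two shifted symbols, (1-β)_{n+1} is rewritten as (1-β)(2-β)_n to fit
the shape of `unitHypTerm`. -/
theorem summand_eq (h : RootParams t u v w α β γ₁ γ₂) (n : ℕ) :
    1 / ((n + 1) * (n + 1 - u)) *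
      (localProd t (entryGen u v w) n / (1 - t * entryGen u v w n)) =
    1 / (1 - β) * unitHypTerm (1 + γ₁) (1 + γ₂) (2 - β) (1 - α) n := by
  have h0 := Nat.cast_add_one_ne_zero (R := ℂ) n
  have h1 := natCast_add_one_sub_ne_zero h.hu n
  rw [h.localProd_eq, h.one_sub_entryGen, unitHypTerm]
  have h5 : pochhammer (1 - β) n * (n + 1 - β) = (1 - β) * pochhammer (2 - β) n := by
    have := pochhammer_succ_left (1 - β) n
    rw [pochhammer_succ, show 1 - β + 1 = 2 - β by ring] at this
    rw [← this]; ring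
  rw [pochhammer_succ]
  have h6 : 1 / ((n + 1) * (n + 1 - u)) *
      (pochhammer (1 + γ₁) n * pochhammer (1 + γ₂) n / (pochhammer (1 - α) n * pochhammer (1 - β) n) /
        ((n + 1 - α) * (n + 1 - β) / ((n + 1) * (n + 1 - u)))) =
      pochhammer (1 + γ₁) n * pochhammer (1 + γ₂) n /
        (pochhammer (1 - α) n * (n + 1 - α) * (pochhammer (1 - β) n * (n + 1 - β))) := by
    field_simp
  rw [h6, h5]
  simp only [div_eq_mul_inv, mul_inv]
  ring

/-- Makes the excess of the resulting series equal to 1 - v; this is where |v| < 1 gives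
convergence. -/
theorem sum_params (h : RootParams t u v w α β γ₁ γ₂) : γ₁ + γ₂ + α + β = v := by
  linear_combination h.sum_γ + h.sum_αβ

theorem re_lt_one {x : ℂ} (hx : ‖x‖ < 1) : x.re < 1 := (Complex.re_le_norm x).trans_lt hx

theorem summable_summand (h : RootParams t u v w α β γ₁ γ₂) (hv : ‖v‖ < 1) :
    Summable fun n : ℕ => ‖1 / ((n + 1) * (n + 1 - u)) *
      (localProd t (entryGen u v w) n / (1 - t * entryGen u v w n))‖ := by
  simp_rw [h.summand_eq, norm_mul (1 / (1 - β))]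
  refine (unitHypTerm_summable ?_).mul_left _
  have h1 := congrArg Complex.re h.sum_params
  have h2 := re_lt_one hv
  simp at h1 ⊢
  linarith

end RootParams

theorem exists_add_mul_eq (s p : ℂ) : ∃ x y : ℂ, x + y = s ∧ x * y = p := by
  obtain ⟨r, hr⟩ := IsAlgClosed.exists_pow_nat_eq (s ^ 2 - 4 * p) (n := 2) two_pos
  refine ⟨(s + r) / 2, (s - r) / 2, by ring, ?_⟩
  linear_combination -hr / 4

theorem exists_rootParams {t u v w : ℂ} (hu : ‖u‖ < 1) (htv : ‖t‖ * ‖v‖ < 1)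
    (hw : ‖t‖ * ‖w‖ ^ 2 < (1 - ‖u‖) * (1 - ‖t‖ * ‖v‖)) :
    ∃ α β γ₁ γ₂, RootParams t u v w α β γ₁ γ₂ := by
  obtain ⟨α, β, h1, h2⟩ := exists_add_mul_eq (u + v * t) (t * (u * v - w ^ 2))
  obtain ⟨γ₁, γ₂, h3, h4⟩ := exists_add_mul_eq (-u - (t - 1) * v) ((t - 1) * (u * v - w ^ 2))
  exact ⟨α, β, γ₁, γ₂, hu, htv, hw, h1, h2, h3, h4⟩

/-- Summability of the majorant built from real parameters. -/
theorem summable_real_summand {t u v w : ℝ} (ht0 : 0 ≤ t) (hu0 : 0 ≤ u) (hv0 : 0 ≤ v)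
    (hu : u < 1) (hv : v < 1) (htv : t * v < 1) (hw : t * w ^ 2 < (1 - u) * (1 - t * v)) :
    Summable fun n : ℕ => 1 / (((n : ℝ) + 1) * (n + 1 - u)) *
      (localProd t (entryGen u v w) n / (1 - t * entryGen u v w n)) := by
  have e : ∀ x : ℝ, 0 ≤ x → ‖(x : ℂ)‖ = x := fun x hx => by
    rw [Complex.norm_real, Real.norm_of_nonneg hx]
  have ew : ‖(w : ℂ)‖ ^ 2 = w ^ 2 := by rw [Complex.norm_real, Real.norm_eq_abs, sq_abs]
  -- The quadratics may have non-real roots even for real parameters, so summability is obtained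
  -- over ℂ and transferred back.
  obtain ⟨α, β, γ₁, γ₂, h⟩ := exists_rootParams (t := t) (u := u) (v := v) (w := w)
    (by rwa [e u hu0]) (by rwa [e t ht0, e v hv0]) (by rwa [e u hu0, e t ht0, e v hv0, ew])
  refine Summable.of_norm ?_
  refine (h.summable_summand (by rwa [e v hv0])).congr fun n => ?_
  rw [← Complex.norm_real]
  congr 1
  simp [localProd, entryGen]

/-! ### Weighted tail sums and their nonnegative majorants -/

/-- `tailSum t (k₂,…) n` is the sum of the contributions of the entries `k₂,…` of an index to the
interpolated multiple zeta value when its first summation index is `n + 1`. -/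
def tailSum {K : Type*} [Field K] (t : K) : List ℕ → ℕ → K
  | [], _ => 1
  | a :: l, n => ∑ j ∈ Finset.range n, tailSum t l j / ((j : K) + 1) ^ a +
      t * (tailSum t l n / ((n : K) + 1) ^ a)

/-- The weight of an entry which is not the first one. -/
def entryWeight {K : Type*} [Field K] (u v w : K) : ℕ → K
  | 0 => 0
  | 1 => v
  | a + 2 => w ^ 2 * u ^ a

/-- The product of the weights of the entries. -/
def listWeight {K : Type*} [Field K] (u v w : K) (l : List ℕ) : K :=
  (l.map (entryWeight u v w)).prod

section Field
variable {K : Type*} [Field K]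

@[simp] theorem listWeight_nil (u v w : K) : listWeight u v w [] = 1 := rfl

@[simp] theorem listWeight_cons (u v w : K) (a : ℕ) (l : List ℕ) :
    listWeight u v w (a :: l) = entryWeight u v w a * listWeight u v w l := by
  simp [listWeight]

theorem listWeight_mul_tailSum_cons (t u v w : K) (a : ℕ) (l : List ℕ) (n : ℕ) :
    listWeight u v w (a :: l) * tailSum t (a :: l) n =
      ∑ j ∈ Finset.range n, entryWeight u v w a / ((j : K) + 1) ^ a *
        (listWeight u v w l * tailSum t l j) +
      t * (entryWeight u v w a / ((n : K) + 1) ^ a * (listWeight u v w l * tailSum t l n)) := by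
  rw [listWeight_cons, tailSum, mul_add, Finset.mul_sum]
  congr 1
  · refine Finset.sum_congr rfl fun j _ => by ring
  · ring

end Field

theorem HasSum.congr_left {ι M : Type*} [AddCommMonoid M] [TopologicalSpace M] {f g : ι → M} {a : M}
    (h : HasSum g a) (e : ∀ i, f i = g i) : HasSum f a := by
  rwa [funext e]

section RCLike
variable {𝕜 : Type*} [RCLike 𝕜]

theorem norm_natCast_add_one (n : ℕ) : ‖(n : 𝕜) + 1‖ = n + 1 := by
  have := RCLike.norm_natCast (K := 𝕜) (n + 1)
  push_cast at this
  exact this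

theorem hasSum_geometric_entry {u : 𝕜} (hu : ‖u‖ < 1) (n : ℕ) :
    HasSum (fun a : ℕ => u ^ a / ((n : 𝕜) + 1) ^ (a + 2)) (1 / (((n : 𝕜) + 1) * (n + 1 - u))) := by
  have h0 := Nat.cast_add_one_ne_zero (R := 𝕜) n
  have hn : (0 : ℝ) ≤ n := n.cast_nonneg
  have h1 : ‖u / ((n : 𝕜) + 1)‖ < 1 := by
    rw [norm_div, norm_natCast_add_one, div_lt_one (by positivity)]
    linarith
  have h2 : (n : 𝕜) + 1 - u ≠ 0 := by
    intro h
    rw [sub_eq_zero] at h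
    rw [← h, norm_natCast_add_one] at hu
    linarith
  have h3 := (hasSum_geometric_of_norm_lt_one h1).mul_left (1 / ((n : 𝕜) + 1) ^ 2)
  have h4 : 1 / (((n : 𝕜) + 1) * (n + 1 - u)) =
      1 / ((n : 𝕜) + 1) ^ 2 * (1 - u / ((n : 𝕜) + 1))⁻¹ := by
    have : 1 - u / ((n : 𝕜) + 1) = (n + 1 - u) / (n + 1) := by field_simp
    rw [this]
    field_simp
  rw [h4]
  refine h3.congr_left fun a => ?_
  rw [div_pow, pow_add]
  field_simp

theorem hasSum_entryWeight {u : 𝕜} (v w : 𝕜) (hu : ‖u‖ < 1) (n : ℕ) :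
    HasSum (fun a : ℕ => entryWeight u v w a / ((n : 𝕜) + 1) ^ a) (entryGen u v w n) := by
  rw [← hasSum_nat_add_iff' 2]
  have h1 : entryGen u v w n - ∑ i ∈ Finset.range 2, entryWeight u v w i / ((n : 𝕜) + 1) ^ i =
      w ^ 2 * (1 / (((n : 𝕜) + 1) * (n + 1 - u))) := by
    simp only [Finset.sum_range_succ, Finset.sum_range_zero, entryWeight, entryGen]
    ring
  rw [h1]
  refine ((hasSum_geometric_entry hu n).mul_left (w ^ 2)).congr_left fun a => ?_
  simp only [entryWeight]
  ring

theorem norm_entryWeight (u v w : 𝕜) (a : ℕ) :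
    ‖entryWeight u v w a‖ = entryWeight ‖u‖ ‖v‖ ‖w‖ a := by
  match a with
  | 0 => simp [entryWeight]
  | 1 => simp [entryWeight]
  | a + 2 => simp [entryWeight]

theorem norm_listWeight (u v w : 𝕜) (l : List ℕ) :
    ‖listWeight u v w l‖ = listWeight ‖u‖ ‖v‖ ‖w‖ l := by
  induction l with
  | nil => simp
  | cons a l ih => simp [ih, norm_entryWeight]

theorem norm_tailSum_le (t : 𝕜) (l : List ℕ) (n : ℕ) : ‖tailSum t l n‖ ≤ tailSum ‖t‖ l n := by
  induction l generalizing n with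
  | nil => simp [tailSum]
  | cons a l ih =>
    rw [tailSum, tailSum]
    refine (norm_add_le _ _).trans (add_le_add ((norm_sum_le _ _).trans
      (Finset.sum_le_sum fun j _ => ?_)) ?_)
    · rw [norm_div, norm_pow, norm_natCast_add_one]
      gcongr
      exact ih j
    · rw [norm_mul, norm_div, norm_pow, norm_natCast_add_one]
      gcongr
      exact ih n

end RCLike

section Real
variable {t u v w : ℝ}

theorem entryWeight_nonneg (hu : 0 ≤ u) (hv : 0 ≤ v) (a : ℕ) : 0 ≤ entryWeight u v w a := by
  match a with
  | 0 => exact le_rfl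
  | 1 => exact hv
  | a + 2 => exact mul_nonneg (sq_nonneg w) (pow_nonneg hu a)

theorem listWeight_nonneg (hu : 0 ≤ u) (hv : 0 ≤ v) (l : List ℕ) : 0 ≤ listWeight u v w l := by
  induction l with
  | nil => simp
  | cons a l ih => rw [listWeight_cons]; exact mul_nonneg (entryWeight_nonneg hu hv a) ih

theorem tailSum_nonneg (ht : 0 ≤ t) (l : List ℕ) (n : ℕ) : 0 ≤ tailSum t l n := by
  induction l generalizing n with
  | nil => simp [tailSum]
  | cons a l ih =>
    rw [tailSum]
    have := ih n
    refine add_nonneg (Finset.sum_nonneg fun j _ => ?_) (by positivity)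
    have := ih j
    positivity

theorem entryGen_nonneg (hu : u < 1) (hv : 0 ≤ v) (n : ℕ) : 0 ≤ entryGen u v w n := by
  have hn : (0 : ℝ) ≤ n := n.cast_nonneg
  have : 0 < (n : ℝ) + 1 - u := by linarith
  rw [entryGen]
  positivity

/-- y_n is at most y_0 = v + w²/(1-u), and t y_0 < 1 is the hypothesis on w divided by 1 - u. -/
theorem mul_entryGen_lt_one (ht : 0 ≤ t) (hu : u < 1) (hv : 0 ≤ v)
    (hw : t * w ^ 2 < (1 - u) * (1 - t * v)) (n : ℕ) : t * entryGen u v w n < 1 := by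
  have hn : (0 : ℝ) ≤ n := n.cast_nonneg
  have h1 : 0 < 1 - u := by linarith
  have h2 : 0 < (n : ℝ) + 1 - u := by linarith
  have h3 : entryGen u v w n ≤ v + w ^ 2 / (1 - u) := by
    rw [entryGen]
    refine add_le_add (div_le_self hv (by linarith)) ?_
    refine div_le_div_of_nonneg_left (sq_nonneg w) h1 ?_
    nlinarith
  have h4 : t * (v + w ^ 2 / (1 - u)) < 1 := by
    rw [mul_add, ← mul_div_assoc, ← lt_sub_iff_add_lt', div_lt_iff₀ h1]
    linarith
  exact (mul_le_mul_of_nonneg_left h3 ht).trans_lt h4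

theorem localProd_nonneg {y : ℕ → ℝ} (hy : ∀ n, 0 ≤ y n) (h : ∀ n, t * y n < 1) (n : ℕ) :
    0 ≤ localProd t y n := by
  refine Finset.prod_nonneg fun j _ => ?_
  have := hy j
  have := sub_pos.2 (h j)
  positivity

/-- Induction on the length bound: the closed form is a fixed point of the recursion and all terms
are nonnegative, so a bound for shorter tails propagates through one more entry. -/
theorem sum_listWeight_tailSum_le (ht : 0 ≤ t) (hu0 : 0 ≤ u) (hu : u < 1) (hv : 0 ≤ v)
    (hw : t * w ^ 2 < (1 - u) * (1 - t * v)) (N : ℕ) (s : Finset (List ℕ))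
    (hs : ∀ l ∈ s, l.length ≤ N) (n : ℕ) :
    ∑ l ∈ s, listWeight u v w l * tailSum t l n ≤
      localProd t (entryGen u v w) n / (1 - t * entryGen u v w n) := by
  have hy := entryGen_nonneg (w := w) hu hv
  have hty := mul_entryGen_lt_one ht hu hv hw
  have hP := localProd_nonneg hy hty
  have hc : ∀ n, 0 ≤ localProd t (entryGen u v w) n / (1 - t * entryGen u v w n) := fun n =>
    div_nonneg (hP n) (sub_pos.2 (hty n)).le
  have hnn : ∀ l n, 0 ≤ listWeight u v w l * tailSum t l n := fun l n =>
    mul_nonneg (listWeight_nonneg hu0 hv l) (tailSum_nonneg ht l n)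
  induction N generalizing s n with
  | zero =>
    have h1 : s ⊆ {[]} := fun l hl => by simpa using hs l hl
    refine (Finset.sum_le_sum_of_subset_of_nonneg h1 fun l _ _ => hnn l n).trans ?_
    rw [localProd_div_eq (sub_pos.2 (hty n)).ne', add_assoc]
    simp only [Finset.sum_singleton, listWeight_nil, tailSum, mul_one, le_add_iff_nonneg_right]
    exact add_nonneg (Finset.sum_nonneg fun j _ => mul_nonneg (hy j) (hc j))
      (mul_nonneg ht (mul_nonneg (hy n) (hc n)))
  | succ N ih =>
    classical
    set A := s.image fun l => l.headD 0
    set B := (s.image List.tail).filter fun l => l.length ≤ N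
    -- Enlarging `s` to the empty list together with all combinations of a head from `A` and a tail
    -- from `B` makes the sum factor.
    have h1 : s ⊆ insert [] ((A ×ˢ B).image fun p => p.1 :: p.2) := by
      intro l hl
      cases l with
      | nil => simp
      | cons a l =>
        refine Finset.mem_insert_of_mem (Finset.mem_image.2 ⟨(a, l), ?_, rfl⟩)
        have := hs _ hl
        refine Finset.mem_product.2 ⟨Finset.mem_image.2 ⟨_, hl, rfl⟩, Finset.mem_filter.2
          ⟨Finset.mem_image.2 ⟨_, hl, rfl⟩, by simpa using this⟩⟩
    have hB : ∀ j, ∑ l ∈ B, listWeight u v w l * tailSum t l j ≤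
        localProd t (entryGen u v w) j / (1 - t * entryGen u v w j) := fun j =>
      ih B (fun l hl => (Finset.mem_filter.1 hl).2) j
    have hA : ∀ j : ℕ, ∑ a ∈ A, entryWeight u v w a / ((j : ℝ) + 1) ^ a ≤ entryGen u v w j :=
      fun j => sum_le_hasSum _ (fun a _ => div_nonneg (entryWeight_nonneg hu0 hv a) (by positivity))
        (hasSum_entryWeight v w (by rwa [Real.norm_of_nonneg hu0]) j)
    have hAB : ∀ j : ℕ, ∑ p ∈ A ×ˢ B, entryWeight u v w p.1 / ((j : ℝ) + 1) ^ p.1 *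
        (listWeight u v w p.2 * tailSum t p.2 j) ≤ entryGen u v w j *
        (localProd t (entryGen u v w) j / (1 - t * entryGen u v w j)) := fun j => by
      rw [Finset.sum_product]
      refine (Finset.sum_mul_sum A B (fun a => entryWeight u v w a / ((j : ℝ) + 1) ^ a)
        fun l => listWeight u v w l * tailSum t l j).symm.le.trans ?_
      exact mul_le_mul (hA j) (hB j) (Finset.sum_nonneg fun l _ => hnn l j) (hy j)
    refine (Finset.sum_le_sum_of_subset_of_nonneg h1 fun l _ _ => hnn l n).trans ?_
    rw [Finset.sum_insert (by simp), Finset.sum_image (by intro p _ q _ h; simpa [Prod.ext_iff] using h),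
      localProd_div_eq (sub_pos.2 (hty n)).ne', add_assoc]
    simp only [listWeight_nil, tailSum.eq_1, mul_one, add_le_add_iff_left,
      listWeight_mul_tailSum_cons, Finset.sum_add_distrib]
    rw [Finset.sum_comm, ← Finset.mul_sum]
    exact add_le_add (Finset.sum_le_sum fun j _ => hAB j) (mul_le_mul_of_nonneg_left (hAB n) ht)

theorem summable_listWeight_tailSum (ht : 0 ≤ t) (hu0 : 0 ≤ u) (hu : u < 1) (hv : 0 ≤ v)
    (hw : t * w ^ 2 < (1 - u) * (1 - t * v)) (n : ℕ) :
    Summable (fun l => listWeight u v w l * tailSum t l n) ∧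
    ∑' l, listWeight u v w l * tailSum t l n ≤
      localProd t (entryGen u v w) n / (1 - t * entryGen u v w n) := by
  have h1 : ∀ s : Finset (List ℕ), ∑ l ∈ s, listWeight u v w l * tailSum t l n ≤
      localProd t (entryGen u v w) n / (1 - t * entryGen u v w n) := fun s =>
    sum_listWeight_tailSum_le ht hu0 hu hv hw (s.sup List.length) s
      (fun l hl => Finset.le_sup (f := List.length) hl) n
  have h0 : ∀ l, 0 ≤ listWeight u v w l * tailSum t l n := fun l =>
    mul_nonneg (listWeight_nonneg hu0 hv l) (tailSum_nonneg ht l n)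
  exact ⟨summable_of_sum_le h0 h1, Real.tsum_le_of_sum_le h0 h1⟩

end Real

/-! ### The generating function of all tails -/

theorem HasSum.list_cons {M : Type*} [AddCommMonoid M] [TopologicalSpace M] [ContinuousAdd M]
    {f : List ℕ → M} {a : M} (h : HasSum (fun p : ℕ × List ℕ => f (p.1 :: p.2)) a) :
    HasSum f (f [] + a) := by
  classical
  have hinj : Function.Injective fun p : ℕ × List ℕ => p.1 :: p.2 := fun p q h => by
    simpa [Prod.ext_iff] using h
  have h1 : HasSum (fun l => if l = [] then 0 else f l) a := by
    rw [← hinj.hasSum_iff]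
    · simpa [Function.comp_def] using h
    · intro l hl
      cases l with
      | nil => simp
      | cons a l => exact absurd ⟨(a, l), rfl⟩ hl
  convert (hasSum_ite_eq ([] : List ℕ) (f [])).add h1 using 1
  funext l
  by_cases hl : l = [] <;> simp [hl]

theorem hasSum_mul_of_summable_norm {𝕜 ι κ : Type*} [RCLike 𝕜] {f : ι → 𝕜} {g : κ → 𝕜} {a : 𝕜}
    (ha : HasSum f a) (hf : Summable fun i => ‖f i‖) (hg : Summable fun i => ‖g i‖) :
    HasSum (fun p : ι × κ => f p.1 * g p.2) (a * ∑' i, g i) := by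
  have h1 := tsum_mul_tsum_of_summable_norm hf hg
  rw [ha.tsum_eq] at h1
  rw [h1]
  exact (summable_mul_of_summable_norm hf hg).hasSum

section RCLike
variable {𝕜 : Type*} [RCLike 𝕜] {t u v w : 𝕜}

theorem summable_norm_listWeight_tailSum (hu : ‖u‖ < 1)
    (hw : ‖t‖ * ‖w‖ ^ 2 < (1 - ‖u‖) * (1 - ‖t‖ * ‖v‖)) (n : ℕ) :
    Summable (fun l => ‖listWeight u v w l * tailSum t l n‖) ∧
    ∑' l, ‖listWeight u v w l * tailSum t l n‖ ≤
      localProd ‖t‖ (entryGen ‖u‖ ‖v‖ ‖w‖) n / (1 - ‖t‖ * entryGen ‖u‖ ‖v‖ ‖w‖ n) := by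
  have h := summable_listWeight_tailSum (norm_nonneg t) (norm_nonneg u) hu (norm_nonneg v) hw n
  have hle : ∀ l, ‖listWeight u v w l * tailSum t l n‖ ≤
      listWeight ‖u‖ ‖v‖ ‖w‖ l * tailSum ‖t‖ l n := fun l => by
    rw [norm_mul, norm_listWeight]
    exact mul_le_mul_of_nonneg_left (norm_tailSum_le t l n)
      (listWeight_nonneg (norm_nonneg u) (norm_nonneg v) l)
  have h1 := Summable.of_nonneg_of_le (fun l => norm_nonneg _) hle h.1
  exact ⟨h1, (h1.tsum_le_tsum hle h.1).trans h.2⟩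

/-- Expanding y_n as the series of entry weights bounds |y_n| by its value at |u|, |v|, |w|, hence
|t y_n| < 1. -/
theorem one_sub_mul_entryGen_ne_zero (hu : ‖u‖ < 1)
    (hw : ‖t‖ * ‖w‖ ^ 2 < (1 - ‖u‖) * (1 - ‖t‖ * ‖v‖)) (n : ℕ) :
    1 - t * entryGen u v w n ≠ 0 := by
  intro h
  have h1 := mul_entryGen_lt_one (norm_nonneg t) hu (norm_nonneg v) hw n
  have h2 : ‖entryGen u v w n‖ ≤ entryGen ‖u‖ ‖v‖ ‖w‖ n := by
    refine tsum_of_norm_bounded (hasSum_entryWeight ‖v‖ ‖w‖ (by simpa using hu) n)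
      (f := fun a => entryWeight u v w a / ((n : 𝕜) + 1) ^ a) (fun a => ?_) |>.trans_eq' ?_
    · rw [norm_div, norm_entryWeight, norm_pow, norm_natCast_add_one]
    · rw [(hasSum_entryWeight v w hu n).tsum_eq]
  have h3 : ‖t * entryGen u v w n‖ = 1 := by
    rw [← sub_eq_zero.1 h, norm_one]
  rw [norm_mul] at h3
  have := mul_le_mul_of_nonneg_left h2 (norm_nonneg t)
  linarith

theorem hasSum_entryWeight_mul (hu : ‖u‖ < 1) (j : ℕ)
    (hs : Summable fun l => ‖listWeight u v w l * tailSum t l j‖) :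
    HasSum (fun p : ℕ × List ℕ => entryWeight u v w p.1 / ((j : 𝕜) + 1) ^ p.1 *
      (listWeight u v w p.2 * tailSum t p.2 j))
      (entryGen u v w j * ∑' l, listWeight u v w l * tailSum t l j) := by
  have h1 := hasSum_entryWeight v w hu j
  have hx : Summable fun a => ‖entryWeight u v w a / ((j : 𝕜) + 1) ^ a‖ := by
    simp_rw [norm_div, norm_entryWeight, norm_pow, norm_natCast_add_one]
    exact (hasSum_entryWeight ‖v‖ ‖w‖ (by simpa using hu) j).summable
  have h0 := hasSum_mul_of_summable_norm
    (f := fun a => entryWeight u v w a / ((j : 𝕜) + 1) ^ a) h1 hx hs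
  exact h0

theorem hasSum_listWeight_tailSum_cons (hu : ‖u‖ < 1) {G : ℕ → 𝕜}
    (hs : ∀ n, Summable fun l => ‖listWeight u v w l * tailSum t l n‖)
    (hG : ∀ n, ∑' l, listWeight u v w l * tailSum t l n = G n) (n : ℕ) :
    HasSum (fun p : ℕ × List ℕ => listWeight u v w (p.1 :: p.2) * tailSum t (p.1 :: p.2) n)
      (∑ j ∈ Finset.range n, entryGen u v w j * G j + t * (entryGen u v w n * G n)) := by
  have hprod := fun j : ℕ => hasSum_entryWeight_mul hu j (hs j)
  simp_rw [hG] at hprod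
  have h0 := (hasSum_sum fun j (_ : j ∈ Finset.range n) => hprod j).add ((hprod n).mul_left t)
  exact h0.congr_left fun p => listWeight_mul_tailSum_cons t u v w p.1 p.2 n

/-- The generating function of the tail sums over all indices. -/
theorem hasSum_listWeight_tailSum (hu : ‖u‖ < 1)
    (hw : ‖t‖ * ‖w‖ ^ 2 < (1 - ‖u‖) * (1 - ‖t‖ * ‖v‖)) (n : ℕ) :
    HasSum (fun l => listWeight u v w l * tailSum t l n)
      (localProd t (entryGen u v w) n / (1 - t * entryGen u v w n)) := by
  have hs : ∀ n, Summable fun l => ‖listWeight u v w l * tailSum t l n‖ := fun n =>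
    (summable_norm_listWeight_tailSum hu hw n).1
  obtain ⟨G, hGdef⟩ : ∃ G : ℕ → 𝕜, ∀ n, ∑' l, listWeight u v w l * tailSum t l n = G n :=
    ⟨_, fun n => rfl⟩
  have hG : ∀ n, G n = 1 + ∑ j ∈ Finset.range n, entryGen u v w j * G j +
      t * (entryGen u v w n * G n) := fun n => by
    have h1 := (HasSum.list_cons (f := fun l => listWeight u v w l * tailSum t l n)
      (hasSum_listWeight_tailSum_cons hu hs hGdef n)).tsum_eq
    rw [listWeight_nil, tailSum, one_mul, ← add_assoc, hGdef] at h1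
    exact h1
  rw [← eq_localProd_div (one_sub_mul_entryGen_ne_zero hu hw) hG n, ← hGdef]
  exact (hs n).of_norm.hasSum

end RCLike

/-! ### Summation over admissible indices and the largest summation index -/

section RCLike
variable {𝕜 : Type*} [RCLike 𝕜] {t u v w : 𝕜}

/-- The summand indexed by the first entry `p.1.1 + 2` and the tail `p.1.2` of an admissible
index, and by its first summation index `p.2 + 1`. -/
def admissibleTerm (t u v w : 𝕜) (p : (ℕ × List ℕ) × ℕ) : 𝕜 :=
  u ^ p.1.1 / ((p.2 : 𝕜) + 1) ^ (p.1.1 + 2) * (listWeight u v w p.1.2 * tailSum t p.1.2 p.2)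

theorem hasSum_admissibleTerm_fiber (hu : ‖u‖ < 1)
    (hw : ‖t‖ * ‖w‖ ^ 2 < (1 - ‖u‖) * (1 - ‖t‖ * ‖v‖)) (n : ℕ) :
    HasSum (fun q : ℕ × List ℕ => admissibleTerm t u v w (q, n))
      (1 / (((n : 𝕜) + 1) * (n + 1 - u)) *
        (localProd t (entryGen u v w) n / (1 - t * entryGen u v w n))) := by
  have hx : Summable fun a : ℕ => ‖u ^ a / ((n : 𝕜) + 1) ^ (a + 2)‖ := by
    simp_rw [norm_div, norm_pow, norm_natCast_add_one]
    exact (hasSum_geometric_entry (𝕜 := ℝ) (by simpa using hu) n).summable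
  have h0 := hasSum_mul_of_summable_norm (f := fun a : ℕ => u ^ a / ((n : 𝕜) + 1) ^ (a + 2))
    (hasSum_geometric_entry hu n) hx (summable_norm_listWeight_tailSum hu hw n).1
  rw [(hasSum_listWeight_tailSum hu hw n).tsum_eq] at h0
  exact h0

theorem hasSum_norm_admissibleTerm_fiber (hu : ‖u‖ < 1)
    (hw : ‖t‖ * ‖w‖ ^ 2 < (1 - ‖u‖) * (1 - ‖t‖ * ‖v‖)) (n : ℕ) :
    HasSum (fun q : ℕ × List ℕ => ‖admissibleTerm t u v w (q, n)‖)
      (1 / (((n : ℝ) + 1) * (n + 1 - ‖u‖)) * ∑' l, ‖listWeight u v w l * tailSum t l n‖) := by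
  have hx := hasSum_geometric_entry (𝕜 := ℝ) (u := ‖u‖) (by simpa using hu) n
  have h0 := hasSum_mul_of_summable_norm (f := fun a : ℕ => ‖u‖ ^ a / ((n : ℝ) + 1) ^ (a + 2))
    (g := fun l => ‖listWeight u v w l * tailSum t l n‖)
    hx hx.summable.norm (summable_norm_listWeight_tailSum hu hw n).1.norm
  refine h0.congr_left fun q => ?_
  rw [admissibleTerm, norm_mul, norm_div, norm_pow, norm_pow, norm_natCast_add_one]

/-- Sums over the indices first, for fixed n, where the closed form with absolute values is a
majorant; that majorant is summable over n. -/
theorem summable_norm_admissibleTerm (hu : ‖u‖ < 1) (hv : ‖v‖ < 1) (htv : ‖t‖ * ‖v‖ < 1)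
    (hw : ‖t‖ * ‖w‖ ^ 2 < (1 - ‖u‖) * (1 - ‖t‖ * ‖v‖)) :
    Summable fun p => ‖admissibleTerm t u v w p‖ := by
  rw [← (Equiv.prodComm ℕ (ℕ × List ℕ)).summable_iff]
  change Summable fun q : ℕ × (ℕ × List ℕ) => ‖admissibleTerm t u v w (q.2, q.1)‖
  rw [summable_prod_of_nonneg fun p => norm_nonneg _]
  refine ⟨fun n => (hasSum_norm_admissibleTerm_fiber hu hw n).summable, ?_⟩
  refine Summable.of_nonneg_of_le (fun n => tsum_nonneg fun q => norm_nonneg _) (fun n => ?_)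
    (summable_real_summand (norm_nonneg t) (norm_nonneg u) (norm_nonneg v) hu hv htv hw)
  have h := (hasSum_norm_admissibleTerm_fiber hu hw n).tsum_eq
  refine h.le.trans (mul_le_mul_of_nonneg_left (summable_norm_listWeight_tailSum hu hw n).2 ?_)
  have hn : (0 : ℝ) ≤ n := n.cast_nonneg
  have : 0 < (n : ℝ) + 1 - ‖u‖ := by linarith
  positivity

theorem tsum_admissibleTerm (hu : ‖u‖ < 1) (hv : ‖v‖ < 1) (htv : ‖t‖ * ‖v‖ < 1)
    (hw : ‖t‖ * ‖w‖ ^ 2 < (1 - ‖u‖) * (1 - ‖t‖ * ‖v‖)) :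
    ∑' p, admissibleTerm t u v w p =
      ∑' n : ℕ, 1 / (((n : 𝕜) + 1) * (n + 1 - u)) *
        (localProd t (entryGen u v w) n / (1 - t * entryGen u v w n)) := by
  have h1 := (summable_norm_admissibleTerm hu hv htv hw).of_norm
  rw [← (Equiv.prodComm ℕ (ℕ × List ℕ)).tsum_eq]
  rw [← (Equiv.prodComm ℕ (ℕ × List ℕ)).summable_iff] at h1
  refine Eq.trans h1.tsum_prod ?_
  exact tsum_congr fun n => (hasSum_admissibleTerm_fiber hu hw n).tsum_eq

end RCLike

/-! ### Multiple zeta values as iterated sums -/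

theorem listWeight_pos {l : List ℕ} (hl : ∀ a ∈ l, 0 < a) :
    0 < listWeight (1 / 2 : ℝ) (1 / 2) 1 l := by
  induction l with
  | nil => simp
  | cons a l ih =>
    rw [listWeight_cons]
    refine mul_pos ?_ (ih fun b hb => hl b (List.mem_cons_of_mem _ hb))
    match a, hl a List.mem_cons_self with
    | 1, _ => norm_num [entryWeight]
    | a + 2, _ => simp [entryWeight]

theorem summable_tailSum_zero {l : List ℕ} (hl : ∀ a ∈ l, 0 < a) (b : ℕ) :
    Summable fun n : ℕ => tailSum (0 : ℝ) l n / ((n : ℝ) + 1) ^ (b + 2) := by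
  -- At t = 0 the condition on w is void, so any u, v in (0,1) and w ≠ 0 serve: all positive lists
  -- then have nonzero weight, which can be divided out of the one series belonging to `(b, l)`.
  have h := summable_norm_admissibleTerm (t := (0 : ℝ)) (u := 1 / 2) (v := 1 / 2) (w := 1)
    (by norm_num) (by norm_num) (by norm_num) (by norm_num)
  have h1 : Summable fun n : ℕ => admissibleTerm (0 : ℝ) (1 / 2) (1 / 2) 1 ((b, l), n) :=
    h.of_norm.prod_factor (b, l)
  have h2 := listWeight_pos hl
  refine (h1.mul_left (((1 / 2 : ℝ) ^ b * listWeight (1 / 2 : ℝ) (1 / 2) 1 l)⁻¹)).congr fun n => ?_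
  rw [admissibleTerm]
  field_simp

open scoped Classical in
/-- The sum over strictly decreasing sequences with largest member in `S`. -/
noncomputable def chainSum (S : ℕ → Prop) (k : List ℕ) : ENNReal :=
  ∑' m : Fin k.length → ℕ, if StrictAnti m ∧ (∀ i, 0 < m i) ∧ ∀ i, S (m i) then
    ENNReal.ofReal (∏ i, 1 / (m i : ℝ) ^ k.get i) else 0

theorem strictAnti_cons_iff {n : ℕ} {M : ℕ} {m : Fin n → ℕ} :
    StrictAnti (Fin.cons M m : Fin (n + 1) → ℕ) ↔ StrictAnti m ∧ ∀ i, m i < M := by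
  constructor
  · intro h
    refine ⟨fun i j hij => ?_, fun i => ?_⟩
    · simpa using h (Fin.succ_lt_succ_iff.2 hij)
    · simpa using h (Fin.succ_pos i)
  · rintro ⟨h1, h2⟩ i j hij
    induction j using Fin.cases with
    | zero => exact absurd hij (Fin.not_lt_zero i)
    | succ j =>
      induction i using Fin.cases with
      | zero => simpa using h2 j
      | succ i => simpa using h1 (Fin.succ_lt_succ_iff.1 hij)

-- Peels off the largest member m₁ = j + 1; the others then range over chains bounded by j, and m₁ =
-- 0 contributes nothing. In `ENNReal` the rearrangement requires no summability.
open scoped Classical in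
theorem chainSum_cons {S : ℕ → Prop} (hS : ∀ i j, i ≤ j → S j → S i) (a : ℕ) (l : List ℕ) :
    chainSum S (a :: l) = ∑' j : ℕ, if S (j + 1) then
      ENNReal.ofReal (1 / ((j : ℝ) + 1) ^ a) * chainSum (· ≤ j) l else 0 := by
  rw [chainSum]
  change ∑' m : Fin (l.length + 1) → ℕ, _ = _
  rw [← (Fin.consEquiv fun _ : Fin (l.length + 1) => ℕ).tsum_eq, ENNReal.tsum_prod',
    tsum_eq_zero_add' ENNReal.summable]
  have h0 : ∀ m : Fin l.length → ℕ, ¬ (∀ i, 0 < (Fin.cons 0 m : Fin (l.length + 1) → ℕ) i) :=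
    fun m h => by simpa using h 0
  have h1 : ∀ (j : ℕ) (m : Fin l.length → ℕ),
      (StrictAnti (Fin.cons (j + 1) m : Fin (l.length + 1) → ℕ) ∧
        (∀ i, 0 < (Fin.cons (j + 1) m : Fin (l.length + 1) → ℕ) i) ∧
        ∀ i, S ((Fin.cons (j + 1) m : Fin (l.length + 1) → ℕ) i)) ↔
      S (j + 1) ∧ StrictAnti m ∧ (∀ i, 0 < m i) ∧ ∀ i, m i ≤ j := by
    intro j m
    rw [strictAnti_cons_iff]
    simp only [Fin.forall_fin_succ, Fin.cons_zero, Fin.cons_succ, Nat.lt_succ_iff]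
    constructor
    · rintro ⟨⟨p1, p2⟩, ⟨-, p3⟩, p4, p5⟩
      exact ⟨p4, p1, p3, p2⟩
    · rintro ⟨p4, p1, p3, p2⟩
      exact ⟨⟨p1, fun i => by simpa using p2 i⟩, ⟨j.zero_le, p3⟩, p4, fun i => hS _ _ ((p2 i).trans j.le_succ) p4⟩
  simp only [Fin.consEquiv_apply]
  have h2 : ∑' m : Fin l.length → ℕ, (if StrictAnti (Fin.cons 0 m : Fin (l.length + 1) → ℕ) ∧
      (∀ i, 0 < (Fin.cons 0 m : Fin (l.length + 1) → ℕ) i) ∧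
      ∀ i, S ((Fin.cons 0 m : Fin (l.length + 1) → ℕ) i) then
      ENNReal.ofReal (∏ i : Fin (l.length + 1),
        1 / ((Fin.cons 0 m : Fin (l.length + 1) → ℕ) i : ℝ) ^ (a :: l).get i) else 0) = 0 := by
    rw [ENNReal.tsum_eq_zero]
    exact fun m => if_neg fun h => h0 m h.2.1
  refine (congrArg₂ (· + ·) h2 (tsum_congr fun j => ?_)).trans (zero_add _)
  split_ifs with hj
  · rw [chainSum, ← ENNReal.tsum_mul_left]
    refine tsum_congr fun m => ?_
    rw [mul_ite, mul_zero]
    by_cases hc : StrictAnti m ∧ (∀ i, 0 < m i) ∧ ∀ i, m i ≤ j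
    swap
    · rw [if_neg hc]
      exact if_neg fun h => hc ((h1 j m).1 h).2
    rw [if_pos hc]
    refine (if_pos ((h1 j m).2 ⟨hj, hc⟩)).trans ?_
    rw [← ENNReal.ofReal_mul (by positivity)]
    congr 1
    refine (Fin.prod_univ_succ (n := l.length) _).trans ?_
    simp
  · rw [ENNReal.tsum_eq_zero]
    exact fun m => if_neg fun h => hj ((h1 j m).1 h).1

theorem chainSum_le_eq (l : List ℕ) (n : ℕ) :
    chainSum (· ≤ n) l = ENNReal.ofReal (tailSum (0 : ℝ) l n) := by
  classical
  induction l generalizing n with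
  | nil =>
    rw [chainSum]
    change ∑' m : Fin 0 → ℕ, _ = _
    rw [tsum_fintype, Finset.univ_unique, Finset.sum_singleton, if_pos]
    · change ENNReal.ofReal (∏ i : Fin 0, _) = _
      simp [tailSum]
    · exact ⟨fun i => i.elim0, fun i => i.elim0, fun i => i.elim0⟩
  | cons a l ih =>
    rw [chainSum_cons (fun i j hij hj => hij.trans hj), tsum_eq_sum (s := Finset.range n), tailSum,
      zero_mul, add_zero, ENNReal.ofReal_sum_of_nonneg]
    · refine Finset.sum_congr rfl fun j hj => ?_
      rw [if_pos (Nat.succ_le_of_lt (Finset.mem_range.1 hj)), ih, ← ENNReal.ofReal_mul (by positivity)]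
      congr 1
      ring
    · intro j _
      have := tailSum_nonneg (t := 0) le_rfl l j
      positivity
    · intro j hj
      refine if_neg fun h => hj (Finset.mem_range.2 h)

theorem mzv_eq_toReal (k : List ℕ) : mzv k = (chainSum (fun _ => True) k).toReal := by
  classical
  have h : chainSum (fun _ => True) k =
      ∑' m : {m : Fin k.length → ℕ // StrictAnti m ∧ ∀ i, 0 < m i},
        ENNReal.ofReal (∏ i : Fin k.length, 1 / (m.1 i : ℝ) ^ k.get i) := by
    refine Eq.trans ?_ (tsum_subtype {m : Fin k.length → ℕ | StrictAnti m ∧ ∀ i, 0 < m i} fun m =>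
      ENNReal.ofReal (∏ i : Fin k.length, 1 / (m i : ℝ) ^ k.get i)).symm
    refine tsum_congr fun m => ?_
    simp [Set.indicator_apply]
  rw [h, ENNReal.tsum_toReal_eq fun _ => ENNReal.ofReal_ne_top, mzv]
  refine tsum_congr fun m => (ENNReal.toReal_ofReal ?_).symm
  positivity

/-- Multiple zeta values as single series over the largest summation index. -/
theorem mzv_cons (a : ℕ) (l : List ℕ) :
    mzv (a :: l) = ∑' n : ℕ, tailSum (0 : ℝ) l n / ((n : ℝ) + 1) ^ a := by
  rw [mzv_eq_toReal, chainSum_cons (fun _ _ _ _ => trivial)]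
  simp only [if_true, chainSum_le_eq]
  rw [ENNReal.tsum_toReal_eq fun _ => ENNReal.mul_ne_top ENNReal.ofReal_ne_top ENNReal.ofReal_ne_top]
  refine tsum_congr fun n => ?_
  have := tailSum_nonneg (t := 0) le_rfl l n
  rw [← ENNReal.ofReal_mul (by positivity), ENNReal.toReal_ofReal (by positivity)]
  ring

/-! ### Interpolated values as sums over weakly decreasing sequences -/

/-- The contribution of an index when its first summation index is `n + 1`. -/
def headTerm {K : Type*} [Field K] (t : K) : List ℕ → ℕ → K
  | [], _ => 0
  | a :: l, n => tailSum t l n / ((n : K) + 1) ^ a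

theorem Finset.sum_list_sum_map {ι κ M : Type*} [AddCommMonoid M] (s : Finset ι) (L : List κ)
    (f : ι → κ → M) :
    ∑ i ∈ s, (L.map (f i)).sum = (L.map fun p => ∑ i ∈ s, f i p).sum := by
  induction L with
  | nil => simp
  | cons a L ih => simp [Finset.sum_add_distrib, ih]

theorem HasSum.list_sum_map {ι κ M : Type*} [AddCommMonoid M] [TopologicalSpace M] [ContinuousAdd M]
    {L : List κ} {f : κ → ι → M} {a : κ → M} (h : ∀ p ∈ L, HasSum (f p) (a p)) :
    HasSum (fun i => (L.map fun p => f p i).sum) (L.map a).sum := by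
  induction L with
  | nil => simp
  | cons p L ih =>
    simpa using (h p List.mem_cons_self).add (ih fun q hq => h q (List.mem_cons_of_mem _ hq))

/-- Merging entries can only increase the first one, so every index in the definition of ζᵗ is again
admissible and its series converges. -/
theorem mem_fillBoxesAux {a : ℕ} {l p : List ℕ} (h : p ∈ fillBoxesAux a l)
    (hl : ∀ b ∈ l, 0 < b) :
    ∃ b q, p = b :: q ∧ a ≤ b ∧ (∀ c ∈ q, 0 < c) ∧ q.length ≤ l.length := by
  induction l generalizing a p with
  | nil =>
    rw [fillBoxesAux, List.mem_singleton] at h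
    exact ⟨a, [], h, le_rfl, by simp, le_rfl⟩
  | cons b l ih =>
    have hl' : ∀ c ∈ l, 0 < c := fun c hc => hl c (List.mem_cons_of_mem _ hc)
    rw [fillBoxesAux, List.mem_append, List.mem_map] at h
    rcases h with ⟨q, hq, rfl⟩ | h
    · obtain ⟨c, r, rfl, h1, h2, h3⟩ := ih hq hl'
      refine ⟨a, c :: r, rfl, le_rfl, ?_, by simpa using h3⟩
      have := hl b List.mem_cons_self
      exact List.forall_mem_cons.2 ⟨by omega, h2⟩
    · obtain ⟨c, r, rfl, h1, h2, h3⟩ := ih h hl'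
      exact ⟨c, r, rfl, by omega, h2, h3.trans (by simp)⟩

theorem length_fillBoxesAux {a : ℕ} {l p : List ℕ} (h : p ∈ fillBoxesAux a l) :
    1 ≤ p.length ∧ p.length ≤ l.length + 1 := by
  induction l generalizing a p with
  | nil =>
    rw [fillBoxesAux, List.mem_singleton] at h
    simp [h]
  | cons b l ih =>
    rw [fillBoxesAux, List.mem_append, List.mem_map] at h
    rcases h with ⟨q, hq, rfl⟩ | h
    · have := ih hq
      simp only [List.length_cons]
      omega
    · have := ih h
      simp only [List.length_cons]
      omega

theorem headTerm_zero_cons {K : Type*} [Field K] (a : ℕ) {p : List ℕ} (hp : 1 ≤ p.length) (n : ℕ) :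
    headTerm (0 : K) (a :: p) n =
      (∑ j ∈ Finset.range n, headTerm (0 : K) p j) / ((n : K) + 1) ^ a := by
  cases p with
  | nil => simp at hp
  | cons b q => simp [headTerm, tailSum]

/-- Splits the second summation index according to whether it is smaller than the first (a comma) or
equal to it (a plus: the powers combine to exponent a + b, with a factor t). -/
theorem headTerm_eq_sum {K : Type*} [Field K] (t : K) (a : ℕ) (l : List ℕ) (n : ℕ) :
    headTerm t (a :: l) n = ((fillBoxesAux a l).map fun p =>
      headTerm 0 p n * t ^ (l.length + 1 - p.length)).sum := by
  induction l generalizing a n with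
  | nil => simp [fillBoxesAux, headTerm, tailSum]
  | cons b l ih =>
    have h1 : headTerm t (a :: b :: l) n =
        (∑ j ∈ Finset.range n, headTerm t (b :: l) j) / ((n : K) + 1) ^ a +
          headTerm t ((a + b) :: l) n * t := by
      simp only [headTerm, tailSum]
      rw [add_div, pow_add, add_right_inj, mul_comm ((n + 1 : K) ^ a)]
      simp only [div_eq_mul_inv, mul_inv]
      ring
    rw [h1, ih (a + b)]
    simp_rw [ih b]
    rw [fillBoxesAux, List.map_append, List.sum_append, List.map_map, Finset.sum_list_sum_map,
      div_eq_mul_inv, ← List.sum_map_mul_right, ← List.sum_map_mul_right]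
    congr 2
    · refine List.map_congr_left fun p hp => ?_
      have hp' := length_fillBoxesAux hp
      simp only [Function.comp_apply]
      rw [headTerm_zero_cons a hp'.1, List.length_cons, List.length_cons,
        Nat.add_sub_add_right, ← Finset.sum_mul]
      ring
    · refine List.map_congr_left fun p hp => ?_
      have hp' := length_fillBoxesAux hp
      -- The truncated subtraction is exact because p has at most `l.length + 1` entries; the merge
      -- accounts for the additional factor t.
      rw [List.length_cons, show l.length + 1 + 1 - p.length = l.length + 1 - p.length + 1 by omega,
        pow_succ, mul_assoc]

theorem ofReal_tailSum_zero (l : List ℕ) (n : ℕ) :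
    ((tailSum (0 : ℝ) l n : ℝ) : ℂ) = tailSum (0 : ℂ) l n := by
  induction l generalizing n with
  | nil => simp [tailSum]
  | cons a l ih => simp [tailSum, ih]

theorem hasSum_headTerm_zero {b : ℕ} (hb : 2 ≤ b) {l : List ℕ} (hl : ∀ a ∈ l, 0 < a) :
    HasSum (headTerm (0 : ℂ) (b :: l)) (mzv (b :: l) : ℂ) := by
  obtain ⟨b, rfl⟩ := Nat.exists_eq_add_of_le' hb
  rw [mzv_cons]
  refine (Complex.hasSum_ofReal.2 (summable_tailSum_zero hl b).hasSum).congr_left fun n => ?_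
  simp [headTerm, ofReal_tailSum_zero]

/-- Interpolated multiple zeta values as single series over the largest summation index. -/
theorem hasSum_tmzv (t : ℂ) {a : ℕ} (ha : 2 ≤ a) {l : List ℕ} (hl : ∀ b ∈ l, 0 < b) :
    HasSum (headTerm t (a :: l)) (Polynomial.aeval t (tmzv (a :: l))) := by
  have h1 : Polynomial.aeval t (tmzv (a :: l)) = ((fillBoxesAux a l).map fun p =>
      (mzv p : ℂ) * t ^ (l.length + 1 - p.length)).sum := by
    rw [tmzv, map_list_sum, List.map_map, fillBoxes]
    congr 1
    refine List.map_congr_left fun p _ => ?_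
    simp
  rw [h1]
  refine (HasSum.list_sum_map fun p hp => ?_).congr_left fun n => headTerm_eq_sum t a l n
  obtain ⟨b, q, rfl, hb, hq, -⟩ := mem_fillBoxesAux hp hl
  exact (hasSum_headTerm_zero (ha.trans hb) hq).mul_right _

/-! ### Regrouping by weight, depth and height -/

/-- The contribution to the generating function of the admissible index with first entry
`q.1 + 2` and tail `q.2`. -/
noncomputable def indexTerm (t u v w : ℂ) (q : ℕ × List ℕ) : ℂ :=
  u ^ q.1 * listWeight u v w q.2 * Polynomial.aeval t (tmzv ((q.1 + 2) :: q.2))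

/-- An entry 0 has weight 0, so a sum over all lists of naturals sees only genuine indices. -/
theorem pos_of_listWeight_ne_zero {u v w : ℂ} {l : List ℕ} (h : listWeight u v w l ≠ 0) :
    ∀ a ∈ l, 0 < a := by
  intro a ha
  by_contra! h0
  obtain rfl : a = 0 := by omega
  exact h (List.prod_eq_zero (List.mem_map.2 ⟨0, ha, rfl⟩))

theorem hasSum_indexTerm (t u v w : ℂ) (q : ℕ × List ℕ) :
    HasSum (fun n => admissibleTerm t u v w (q, n)) (indexTerm t u v w q) := by
  by_cases h : listWeight u v w q.2 = 0
  · simp [admissibleTerm, indexTerm, h]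
  · refine ((hasSum_tmzv t (Nat.le_add_left 2 q.1) (pos_of_listWeight_ne_zero h)).mul_left
      (u ^ q.1 * listWeight u v w q.2)).congr_left fun n => ?_
    rw [admissibleTerm, headTerm]
    ring

theorem summable_tsum_indexTerm {t u v w : ℂ} (hu : ‖u‖ < 1) (hv : ‖v‖ < 1) (htv : ‖t‖ * ‖v‖ < 1)
    (hw : ‖t‖ * ‖w‖ ^ 2 < (1 - ‖u‖) * (1 - ‖t‖ * ‖v‖)) :
    Summable (indexTerm t u v w) ∧
      ∑' q, indexTerm t u v w q = ∑' p, admissibleTerm t u v w p := by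
  have h := summable_norm_admissibleTerm hu hv htv hw
  have h1 := h.of_norm.hasSum.prod_fiberwise (hasSum_indexTerm t u v w)
  exact ⟨h1.summable, h1.tsum_eq⟩

theorem listWeight_eq (u v w : ℂ) {l : List ℕ} (hl : ∀ a ∈ l, 0 < a) :
    ∃ x y, l.sum = l.length + indexHeight l + x ∧ l.length = indexHeight l + y ∧
      listWeight u v w l = u ^ x * v ^ y * w ^ (2 * indexHeight l) := by
  induction l with
  | nil => exact ⟨0, 0, by simp [indexHeight]⟩
  | cons a l ih =>
    obtain ⟨x, y, h1, h2, h3⟩ := ih fun b hb => hl b (List.mem_cons_of_mem _ hb)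
    match a, hl a List.mem_cons_self with
    | 1, _ =>
      have hh : indexHeight (1 :: l) = indexHeight l := by simp [indexHeight]
      refine ⟨x, y + 1, ?_, ?_, ?_⟩
      · rw [List.sum_cons, List.length_cons, hh]; omega
      · rw [List.length_cons, hh]; omega
      · rw [listWeight_cons, h3, hh, entryWeight]; ring
    | a + 2, _ =>
      have hh : indexHeight ((a + 2) :: l) = indexHeight l + 1 := by simp [indexHeight]
      refine ⟨x + a, y, ?_, ?_, ?_⟩
      · rw [List.sum_cons, List.length_cons, hh]; omega
      · rw [List.length_cons, hh]; omega
      · rw [listWeight_cons, h3, hh, entryWeight]; ring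

/-- Pairs of a triple `(k, n, s)` and an admissible index of that weight, depth and height. -/
abbrev AdmissiblePair : Type :=
  Σ q : Phi0Index, {c : Composition q.1.1 // c ∈ admissibleIndices q.1.1 q.1.2.1 q.1.2.2}

/-- The first entry, diminished by `2`, and the tail of an admissible index. -/
def AdmissiblePair.split (x : AdmissiblePair) : ℕ × List ℕ :=
  (x.2.1.blocks.headD 0 - 2, x.2.1.blocks.tail)

theorem AdmissiblePair.blocks_eq (x : AdmissiblePair) :
    x.2.1.blocks = (x.split.1 + 2) :: x.split.2 := by
  obtain ⟨q, c, hc⟩ := x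
  have h := (Finset.mem_filter.1 hc).2.1
  simp only [AdmissiblePair.split]
  cases hb : c.blocks with
  | nil => simp [hb] at h
  | cons a l =>
    rw [hb, List.headD_cons] at h
    simp [Nat.sub_add_cancel h]

theorem AdmissiblePair.split_injective : Function.Injective AdmissiblePair.split := by
  intro x y hxy
  have hb : x.2.1.blocks = y.2.1.blocks := by rw [x.blocks_eq, y.blocks_eq, hxy]
  obtain ⟨⟨⟨k, n, s⟩, hq⟩, c, hc⟩ := x
  obtain ⟨⟨⟨k', n', s'⟩, hq'⟩, c', hc'⟩ := y
  simp only at hb hc hc'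
  have h1 := (Finset.mem_filter.1 hc).2.2
  have h2 := (Finset.mem_filter.1 hc').2.2
  obtain rfl : k = k' :=
    c.blocks_sum.symm.trans ((congrArg List.sum hb).trans c'.blocks_sum)
  obtain rfl : n = n' := by rw [← h1.1, ← h2.1, hb]
  obtain rfl : s = s' := by rw [← h1.2, ← h2.2, hb]
  obtain rfl : c = c' := Composition.ext hb
  rfl

theorem AdmissiblePair.mem_range_split {q : ℕ × List ℕ} (hq : ∀ a ∈ q.2, 0 < a) :
    q ∈ Set.range AdmissiblePair.split := by
  obtain ⟨a, l⟩ := q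
  -- Only the relations between weight, depth and height are needed here, so the values of u, v, w
  -- are arbitrary.
  obtain ⟨x, y, h1, h2, -⟩ := listWeight_eq 0 0 0 hq
  simp only at h1 h2
  have hh : indexHeight ((a + 2) :: l) = indexHeight l + 1 := by simp [indexHeight]
  refine ⟨⟨⟨(((a + 2) :: l).sum, ((a + 2) :: l).length, indexHeight ((a + 2) :: l)), ?_⟩,
    ⟨⟨(a + 2) :: l, ?_, rfl⟩, ?_⟩⟩, ?_⟩
  · simp only [List.sum_cons, List.length_cons, hh]
    omega
  · intro i hi
    rcases List.mem_cons.1 hi with rfl | hi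
    · omega
    · exact hq i hi
  · exact Finset.mem_filter.2 ⟨Finset.mem_univ _, by simp, rfl, rfl⟩
  · simp [AdmissiblePair.split]

theorem phi0Term_eq_sum (t u v w : ℂ) (q : Phi0Index) :
    phi0Term t u v w q = ∑ c : {c : Composition q.1.1 // c ∈ admissibleIndices q.1.1 q.1.2.1 q.1.2.2},
      indexTerm t u v w (AdmissiblePair.split ⟨q, c⟩) := by
  rw [phi0Term, sumX0, map_sum, ← Finset.sum_coe_sort, mul_assoc, mul_assoc, Finset.sum_mul]
  refine Finset.sum_congr rfl fun c _ => ?_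
  have hb := AdmissiblePair.blocks_eq ⟨q, c⟩
  simp only at hb
  set z := AdmissiblePair.split ⟨q, c⟩
  have hpos : ∀ a ∈ z.2, 0 < a := fun a ha =>
    c.1.blocks_pos (by rw [hb]; exact List.mem_cons_of_mem _ ha)
  obtain ⟨x, y, h1, h2, h3⟩ := listWeight_eq u v w hpos
  have hh : indexHeight ((z.1 + 2) :: z.2) = indexHeight z.2 + 1 := by simp [indexHeight]
  have hc := (Finset.mem_filter.1 c.2).2.2
  have hs := c.1.blocks_sum
  rw [hb, List.length_cons, hh] at hc
  rw [hb, List.sum_cons] at hs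
  -- The first entry z.1 + 2 adds one to the depth and one to the height, leaving z.1 for the
  -- exponent of u; its unit of height is removed by the -2 in 2s - 2.
  have e1 : q.1.1 - q.1.2.1 - q.1.2.2 = z.1 + x := by omega
  have e2 : q.1.2.1 - q.1.2.2 = y := by omega
  have e3 : 2 * q.1.2.2 - 2 = 2 * indexHeight z.2 := by omega
  rw [indexTerm, h3, hb, e1, e2, e3]
  ring

theorem summable_tsum_phi0Term {t u v w : ℂ} (hu : ‖u‖ < 1) (hv : ‖v‖ < 1) (htv : ‖t‖ * ‖v‖ < 1)
    (hw : ‖t‖ * ‖w‖ ^ 2 < (1 - ‖u‖) * (1 - ‖t‖ * ‖v‖)) :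
    Summable (phi0Term t u v w) ∧ phi0 t u v w = ∑' n : ℕ, 1 / (((n : ℂ) + 1) * (n + 1 - u)) *
      (localProd t (entryGen u v w) n / (1 - t * entryGen u v w n)) := by
  obtain ⟨h1, h2⟩ := summable_tsum_indexTerm hu hv htv hw
  have h3 : HasSum (indexTerm t u v w ∘ AdmissiblePair.split) (∑' q, indexTerm t u v w q) := by
    rw [AdmissiblePair.split_injective.hasSum_iff]
    · exact h1.hasSum
    -- Pairs outside the range have a zero in the tail, hence zero weight.
    · intro q hq
      by_contra h
      exact hq (AdmissiblePair.mem_range_split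
        (pos_of_listWeight_ne_zero (right_ne_zero_of_mul (left_ne_zero_of_mul h))))
  have h4 : HasSum (phi0Term t u v w) (∑' q, indexTerm t u v w q) :=
    (h3.sigma fun q => hasSum_fintype _).congr_left fun q => phi0Term_eq_sum t u v w q
  refine ⟨h4.summable, ?_⟩
  rw [phi0, h4.tsum_eq, h2, tsum_admissibleTerm hu hv htv hw]

/-! ### Evaluation of Φ₀ -/

theorem mainTheorem3 (t u v w α β γ₁ γ₂ : ℂ)
    (hu : ‖u‖ < 1) (hv : ‖v‖ < 1) (htv : ‖t‖ * ‖v‖ < 1)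
    (hw : ‖t‖ * ‖w‖ ^ 2 < (1 - ‖u‖) * (1 - ‖t‖ * ‖v‖))
    (hαβ : α + β = u + v * t) (hαβ' : α * β = t * (u * v - w ^ 2))
    (hγ : γ₁ + γ₂ = -u - (t - 1) * v) (hγ' : γ₁ * γ₂ = (t - 1) * (u * v - w ^ 2)) :
    Summable (phi0Term t u v w) ∧
    IntervalIntegrable
      (fun z : ℝ => (1 - (z : ℂ)) ^ (-β) *
        ordinaryHypergeometric (1 - γ₁ - β) (1 - γ₂ - β) (2 - v) (z : ℂ))
      MeasureTheory.volume 0 1 ∧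
    Summable (hyp32Term (1 - γ₁ - β) (1 - γ₂ - β) 1 (2 - v) (2 - β) 1) ∧
    phi0 t u v w = 1 / (1 - v) *
      ∫ z : ℝ in (0 : ℝ)..1, (1 - (z : ℂ)) ^ (-β) *
        ordinaryHypergeometric (1 - γ₁ - β) (1 - γ₂ - β) (2 - v) (z : ℂ) ∧
    phi0 t u v w = 1 / ((1 - v) * (1 - β)) *
      hyp32 (1 - γ₁ - β) (1 - γ₂ - β) 1 (2 - v) (2 - β) 1 := by
  have hR : RootParams t u v w α β γ₁ γ₂ := ⟨hu, htv, hw, hαβ, hαβ', hγ, hγ'⟩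
  obtain ⟨hsum, hphi⟩ := summable_tsum_phi0Term hu hv htv hw
  have hα1 := RootParams.re_lt_one hR.norm_α
  have hβ1 := RootParams.re_lt_one hR.norm_β
  have hv1 := RootParams.re_lt_one hv
  have hpar := congrArg Complex.re hR.sum_params
  simp only [Complex.add_re] at hpar
  have hβe : 0 < (1 - β).re := by simpa using hβ1
  have hβ0 : 1 - β ≠ 0 := fun h => by simp [h] at hβe
  have hv0 : 1 - v ≠ 0 := fun h => by
    have := congrArg Complex.re h
    simp at this
    linarith
  -- The excess of the transformed series is 1 - α, so convergence comes from |α| < 1.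
  have hexc : (1 - γ₁ - β).re + (1 - γ₂ - β).re < (2 - v).re + (1 - β).re := by
    simp
    linarith
  obtain ⟨hint, hval⟩ := integral_hypergeometric hβe hexc
  rw [show (1 - β - 1 : ℂ) = -β by ring] at hint hval
  have hterm : hyp32Term (1 - γ₁ - β) (1 - γ₂ - β) 1 (2 - v) (2 - β) 1 =
      fun n => (1 - β) * unitHypTerm (1 - γ₁ - β) (1 - γ₂ - β) (2 - v) (1 - β) n := by
    funext n
    rw [← hyp32Term_one_eq hβ0, show (1 - β + 1 : ℂ) = 2 - β by ring]
  have hmain : phi0 t u v w = 1 / (1 - v) *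
      ∑' n, unitHypTerm (1 - γ₁ - β) (1 - γ₂ - β) (2 - v) (1 - β) n := by
    rw [hphi]
    simp_rw [hR.summand_eq]
    -- Thomae's transformation with d = 2 - β, e = 1 - α gives denominator parameters 2 - β and 1 -
    -- v; afterwards the prefactors 1/(1-β) and 1/(1-v) exchange roles, which puts the series in the
    -- form of the integral.
    rw [tsum_mul_left, unitHyp_transform (s := 1 - v) (by simp; linarith) (by simpa using hα1)
      (by simpa using hv1) (by linear_combination hR.sum_params), ← tsum_mul_left, ← tsum_mul_left]
    refine tsum_congr fun n => ?_
    rw [unitHypTerm_eq, unitHypTerm_eq, show 2 - β - (1 + γ₁) = 1 - γ₁ - β by ring,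
      show 2 - β - (1 + γ₂) = 1 - γ₂ - β by ring, show 1 - v + 1 = 2 - v by ring,
      show 1 - β + 1 = 2 - β by ring, mul_comm (pochhammer (2 - β) n)]
    ring
  refine ⟨hsum, hint, ?_, ?_, ?_⟩
  · rw [hterm]
    exact (unitHypTerm_summable hexc).of_norm.mul_left _
  · rw [hmain, hval]
  · rw [hmain, hyp32, hterm, tsum_mul_left]
    field_simp
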